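/- For $d\ge 0$ and a permutation $\sigma$ in the symmetric group $\mathfrak S_d$, let $N(\sigma)$ be the least number of transpositions whose product is $\sigma$. Let $\mathrm{gr}^N\,\mathbb Q[\mathfrak S_d]$ be the graded $\mathbb Q$-algebra associated with the norm filtration on the group algebra: it has a basis $\{[\sigma]\}_{\sigma\in\mathfrak S_d}$, with $[\sigma]$ in norm $N(\sigma)$, and $[\sigma][\tau]=[\sigma\tau]$ if $N(\sigma\tau)=N(\sigma)+N(\tau)$, $[\sigma][\tau]=0$ otherwise. Let $\mathcal A(d)$ be its subalgebra of elements invariant under conjugation by $\mathfrak S_d$; it is a commutative graded $\mathbb Q$-algebra. In $\mathcal A(d)$, let $\gamma_i$ ($i\ge 2$) be the sum of all $[\sigma]$ with $\sigma$ an $i$-cycle, and let $\delta_i$ ($i\ge 1$) be the sum of all $[\sigma]$ with $\sigma$ a product of $i$ disjoint transpositions. Let $C_k=\frac1{k+1}\binom{2k}{k}$ be the Catalan numbers. **Proposition.** Let $m\ge 1$. In $\mathcal A(2m)$ every product $\delta_s\gamma_{m+2-s}$ with $1\le s\le m$ is homogeneous of norm $m+1$, and $$\sum_{s=1}^{m}(-1)^s\,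 s\, C_{m-s}\,\delta_s\,\gamma_{m+2-s}=0 .$$ This relation is nontrivial, in the following sense. For every $1\le s\le m$ there is a polynomial $P_s\in\mathbb Q[X_2,\dots,X_{m+1}]$, homogeneous of degree $s$ when $X_i$ has degree $i-1$, with $P_s(\gamma_2,\dots,\gamma_{m+1})=\delta_s$ in $\mathcal A(2m)$. Moreover, for any polynomials $P_1,\dots,P_m\in\mathbb Q[X_2,\dots,X_{m+1}]$ (homogeneous or not) with $P_s(\gamma_2,\dots,\gamma_{m+1})=\delta_s$ in $\mathcal A(2m)$ for all $1\le s\le m$, the coefficient of $X_2^{m+1}$ in the polynomial $\sum_{s=1}^{m}(-1)^s\, s\, C_{m-s}\,P_s\,X_{m+2-s}$ is nonzero. -/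

import Mathlib

noncomputable section

open Finset

namespace SymGr

open Equiv

/-- The norm `N σ` of a permutation of `{1, …, d}`: the least number of transpositions
whose product is `σ`. -/
def norm {d : ℕ} (σ : Perm (Fin d)) : ℕ :=
  sInf {k | ∃ l : List (Perm (Fin d)), l.length = k ∧ (∀ g ∈ l, g.IsSwap) ∧ l.prod = σ}

theorem norm_le {d : ℕ} {σ : Perm (Fin d)} (l : List (Perm (Fin d)))
    (hl : ∀ g ∈ l, g.IsSwap) (hp : l.prod = σ) : norm σ ≤ l.length :=
  Nat.sInf_le ⟨l, rfl, hl, hp⟩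

theorem exists_list {d : ℕ} (σ : Perm (Fin d)) :
    ∃ l : List (Perm (Fin d)), l.length = norm σ ∧ (∀ g ∈ l, g.IsSwap) ∧ l.prod = σ := by
  have h : {k | ∃ l : List (Perm (Fin d)), l.length = k ∧ (∀ g ∈ l, g.IsSwap) ∧
      l.prod = σ}.Nonempty :=
    ⟨_, (Perm.swapFactors σ).1, rfl, (Perm.swapFactors σ).2.2, (Perm.swapFactors σ).2.1⟩
  exact Nat.sInf_mem h

theorem norm_one {d : ℕ} : norm (1 : Perm (Fin d)) = 0 :=
  Nat.le_zero.mp (norm_le [] (by simp) (by simp))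

theorem norm_mul_le {d : ℕ} (σ τ : Perm (Fin d)) : norm (σ * τ) ≤ norm σ + norm τ := by
  obtain ⟨l, h1, h2, h3⟩ := exists_list σ
  obtain ⟨k, g1, g2, g3⟩ := exists_list τ
  rw [← h1, ← g1, ← List.length_append]
  refine norm_le (l ++ k) ?_ (by simp [h3, g3])
  intro g hg
  rcases List.mem_append.mp hg with h | h
  · exact h2 g h
  · exact g2 g h

theorem norm_conj_le {d : ℕ} (g σ : Perm (Fin d)) : norm (g * σ * g⁻¹) ≤ norm σ := by
  obtain ⟨l, h1, h2, h3⟩ := exists_list σ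
  rw [← h1, ← List.length_map (f := MulAut.conj g)]
  refine norm_le _ ?_ ?_
  · intro x hx
    obtain ⟨y, hy, rfl⟩ := List.mem_map.mp hx
    obtain ⟨a, b, hab, rfl⟩ := h2 y hy
    refine ⟨g a, g b, fun h => hab (g.injective h), ?_⟩
    rw [MulAut.conj_apply, Equiv.swap_apply_apply]
  · rw [← map_list_prod, h3, MulAut.conj_apply]

theorem norm_conj {d : ℕ} (g σ : Perm (Fin d)) : norm (g * σ * g⁻¹) = norm σ := by
  refine le_antisymm (norm_conj_le g σ) ?_
  have h := norm_conj_le g⁻¹ (g * σ * g⁻¹)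
  have e : g⁻¹ * (g * σ * g⁻¹) * g⁻¹⁻¹ = σ := by group
  rwa [e] at h

/-- The graded algebra associated with the filtration of the group algebra `ℚ[𝔖_d]` by the norm.
As a vector space it is `ℚ[𝔖_d]`; an element is given by its coefficients in the basis `[σ]`.
The product is `[σ] * [τ] = [σ * τ]` if `N (σ * τ) = N σ + N τ`, and `[σ] * [τ] = 0` otherwise
(see `single_mul_single`). -/
def Gr (d : ℕ) : Type := Perm (Fin d) → ℚ

namespace Gr

variable {d : ℕ}

instance : AddCommGroup (Gr d) := inferInstanceAs (AddCommGroup (Perm (Fin d) → ℚ))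

instance : Module ℚ (Gr d) := inferInstanceAs (Module ℚ (Perm (Fin d) → ℚ))

/-- The coefficient of `[σ]`. -/
def coeff (f : Gr d) (σ : Perm (Fin d)) : ℚ := f σ

/-- The basis element `[σ]`. -/
def single (σ : Perm (Fin d)) : Gr d := fun τ => if τ = σ then 1 else 0

@[ext] theorem ext {f g : Gr d} (h : ∀ σ, f.coeff σ = g.coeff σ) : f = g := funext h

@[simp] theorem coeff_zero (σ : Perm (Fin d)) : (0 : Gr d).coeff σ = 0 := rfl

@[simp] theorem coeff_add (f g : Gr d) (σ : Perm (Fin d)) :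
    (f + g).coeff σ = f.coeff σ + g.coeff σ := rfl

@[simp] theorem coeff_smul (c : ℚ) (f : Gr d) (σ : Perm (Fin d)) :
    (c • f).coeff σ = c * f.coeff σ := rfl

theorem coeff_single (σ τ : Perm (Fin d)) :
    (single σ).coeff τ = if τ = σ then 1 else 0 := rfl

instance : One (Gr d) := ⟨single 1⟩

instance : Mul (Gr d) := ⟨fun f g ρ => ∑ σ : Perm (Fin d), ∑ τ : Perm (Fin d),
  if σ * τ = ρ ∧ norm (σ * τ) = norm σ + norm τ then f.coeff σ * g.coeff τ else 0⟩

theorem coeff_one (τ : Perm (Fin d)) : (1 : Gr d).coeff τ = if τ = 1 then 1 else 0 := rfl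

theorem coeff_mul (f g : Gr d) (ρ : Perm (Fin d)) :
    (f * g).coeff ρ = ∑ σ : Perm (Fin d), ∑ τ : Perm (Fin d),
      if σ * τ = ρ ∧ norm (σ * τ) = norm σ + norm τ then f.coeff σ * g.coeff τ else 0 := rfl

protected theorem add_mul (f g h : Gr d) : (f + g) * h = f * h + g * h := by
  ext ρ
  simp only [coeff_mul, coeff_add, ← Finset.sum_add_distrib]
  refine Finset.sum_congr rfl fun σ _ => Finset.sum_congr rfl fun τ _ => ?_
  split_ifs <;> ring

protected theorem mul_add (f g h : Gr d) : f * (g + h) = f * g + f * h := by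
  ext ρ
  simp only [coeff_mul, coeff_add, ← Finset.sum_add_distrib]
  refine Finset.sum_congr rfl fun σ _ => Finset.sum_congr rfl fun τ _ => ?_
  split_ifs <;> ring

protected theorem smul_mul (c : ℚ) (f g : Gr d) : (c • f) * g = c • (f * g) := by
  ext ρ
  simp only [coeff_mul, coeff_smul, Finset.mul_sum]
  refine Finset.sum_congr rfl fun σ _ => Finset.sum_congr rfl fun τ _ => ?_
  split_ifs <;> ring

protected theorem mul_smul (c : ℚ) (f g : Gr d) : f * (c • g) = c • (f * g) := by
  ext ρ
  simp only [coeff_mul, coeff_smul, Finset.mul_sum]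
  refine Finset.sum_congr rfl fun σ _ => Finset.sum_congr rfl fun τ _ => ?_
  split_ifs <;> ring

theorem single_mul_single (σ τ : Perm (Fin d)) :
    single σ * single τ = if norm (σ * τ) = norm σ + norm τ then single (σ * τ) else 0 := by
  ext ρ
  rw [coeff_mul, Finset.sum_eq_single σ, Finset.sum_eq_single τ]
  · by_cases h : norm (σ * τ) = norm σ + norm τ <;>
      simp [h, coeff_single, eq_comm]
  · intro b _ hb
    simp [coeff_single, hb]
  · simp
  · intro b _ hb
    simp [coeff_single, hb]
  · simp

theorem coeff_sum {ι : Type*} (t : Finset ι) (f : ι → Gr d) (σ : Perm (Fin d)) :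
    (∑ i ∈ t, f i).coeff σ = ∑ i ∈ t, (f i).coeff σ :=
  Finset.sum_apply (M := fun _ : Perm (Fin d) => ℚ) σ t f

theorem eq_sum (f : Gr d) : f = ∑ σ : Perm (Fin d), f.coeff σ • single σ := by
  ext ρ
  simp [coeff_sum, coeff_single]

theorem single_assoc (σ τ ρ : Perm (Fin d)) :
    single σ * single τ * single ρ = single σ * (single τ * single ρ) := by
  have hz : ∀ x : Gr d, 0 * x = 0 := fun x => by ext; simp [coeff_mul]
  have hz' : ∀ x : Gr d, x * 0 = 0 := fun x => by ext; simp [coeff_mul]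
  have h1 := norm_mul_le σ τ
  have h2 := norm_mul_le τ ρ
  have h3 := norm_mul_le (σ * τ) ρ
  have h4 := norm_mul_le σ (τ * ρ)
  have e := mul_assoc σ τ ρ
  rw [single_mul_single, single_mul_single]
  split_ifs with a b b
  · rw [single_mul_single, single_mul_single, e]
    rw [e] at h3
    split_ifs <;> first | rfl | omega
  · rw [hz', single_mul_single, e, if_neg]
    omega
  · rw [hz, single_mul_single, if_neg]
    rw [e] at h3
    omega
  · rw [hz, hz']

/-- Left multiplication as a bilinear map. -/
def mulBilin (d : ℕ) : Gr d →ₗ[ℚ] Gr d →ₗ[ℚ] Gr d :=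
  LinearMap.mk₂ ℚ (· * ·) Gr.add_mul Gr.smul_mul Gr.mul_add (fun c f g => Gr.mul_smul c f g)

theorem induction {p : Gr d → Prop} (f : Gr d) (h0 : p 0) (hs : ∀ σ, p (single σ))
    (ha : ∀ f g, p f → p g → p (f + g)) (hc : ∀ (c : ℚ) f, p f → p (c • f)) : p f := by
  rw [eq_sum f]
  exact Finset.sum_induction _ p ha h0 fun σ _ => hc _ _ (hs σ)

protected theorem zero_mul (f : Gr d) : 0 * f = 0 := by ext; simp [coeff_mul]

protected theorem mul_zero (f : Gr d) : f * 0 = 0 := by ext; simp [coeff_mul]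

protected theorem mul_assoc (f g h : Gr d) : f * g * h = f * (g * h) := by
  refine induction (p := fun f => f * g * h = f * (g * h)) f (by simp only [Gr.zero_mul])
    (fun σ => ?_) (fun a b ha hb => by simp only [Gr.add_mul, ha, hb])
    (fun c a ha => by simp only [Gr.smul_mul, ha])
  refine induction (p := fun g => single σ * g * h = single σ * (g * h)) g
    (by simp only [Gr.zero_mul, Gr.mul_zero])
    (fun τ => ?_) (fun a b ha hb => by simp only [Gr.add_mul, Gr.mul_add, ha, hb])
    (fun c a ha => by simp only [Gr.smul_mul, Gr.mul_smul, ha])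
  exact induction (p := fun h => single σ * single τ * h = single σ * (single τ * h)) h
    (by simp only [Gr.mul_zero]) (fun ρ => single_assoc σ τ ρ)
    (fun a b ha hb => by simp only [Gr.mul_add, ha, hb])
    (fun c a ha => by simp only [Gr.mul_smul, ha])

protected theorem one_mul (f : Gr d) : 1 * f = f := by
  refine induction (p := fun f => 1 * f = f) f (Gr.mul_zero _) (fun σ => ?_)
    (fun a b ha hb => by simp only [Gr.mul_add, ha, hb])
    (fun c a ha => by simp only [Gr.mul_smul, ha])
  exact (single_mul_single 1 σ).trans (by simp [norm_one])

protected theorem mul_one (f : Gr d) : f * 1 = f := by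
  refine induction (p := fun f => f * 1 = f) f (Gr.zero_mul _) (fun σ => ?_)
    (fun a b ha hb => by simp only [Gr.add_mul, ha, hb])
    (fun c a ha => by simp only [Gr.smul_mul, ha])
  exact (single_mul_single σ 1).trans (by simp [norm_one])

instance : Ring (Gr d) :=
  { (inferInstance : AddCommGroup (Gr d)) with
    mul := (· * ·)
    one := 1
    mul_assoc := Gr.mul_assoc
    one_mul := Gr.one_mul
    mul_one := Gr.mul_one
    zero_mul := Gr.zero_mul
    mul_zero := Gr.mul_zero
    left_distrib := Gr.mul_add
    right_distrib := Gr.add_mul }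

instance : Algebra ℚ (Gr d) := Algebra.ofModule Gr.smul_mul (fun c f g => Gr.mul_smul c f g)

end Gr

/-- The algebra `𝒜(d)`: the elements of the graded algebra `Gr d` that are invariant under
conjugation by `𝔖_d`. -/
def A (d : ℕ) : Subalgebra ℚ (Gr d) where
  carrier := {f | ∀ g σ : Perm (Fin d), f.coeff (g * σ * g⁻¹) = f.coeff σ}
  add_mem' := by
    intro a b ha hb g σ
    simp only [Gr.coeff_add, ha g σ, hb g σ]
  mul_mem' := by
    intro a b ha hb g ρ
    rw [Gr.coeff_mul, Gr.coeff_mul]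
    refine (Fintype.sum_equiv (MulAut.conj g).toEquiv _ _ fun σ =>
      Fintype.sum_equiv (MulAut.conj g).toEquiv _ _ fun τ => ?_).symm
    have e : (g * σ * g⁻¹) * (g * τ * g⁻¹) = g * (σ * τ) * g⁻¹ := by group
    simp only [MulEquiv.toEquiv_eq_coe, MulEquiv.coe_toEquiv, MulAut.conj_apply, e, norm_conj,
      ha g σ, hb g τ, mul_left_inj, mul_right_inj]
  algebraMap_mem' := by
    intro r g σ
    rw [Algebra.algebraMap_eq_smul_one]
    simp [Gr.coeff_one]

theorem mem_A {d : ℕ} {f : Gr d} :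
    f ∈ A d ↔ ∀ g σ : Perm (Fin d), f.coeff (g * σ * g⁻¹) = f.coeff σ := Iff.rfl

theorem mul_comm_of_mem {d : ℕ} (a : Gr d) {b : Gr d} (hb : b ∈ A d) : a * b = b * a := by
  ext ρ
  rw [Gr.coeff_mul, Gr.coeff_mul]
  conv_rhs => rw [Finset.sum_comm]
  refine Finset.sum_congr rfl fun σ _ => ?_
  refine Fintype.sum_equiv (MulAut.conj σ).toEquiv _ _ fun τ => ?_
  have e : (σ * τ * σ⁻¹) * σ = σ * τ := by group
  simp only [MulEquiv.toEquiv_eq_coe, MulEquiv.coe_toEquiv, MulAut.conj_apply, e, norm_conj,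
    mem_A.mp hb σ τ, add_comm (norm τ), mul_comm (b.coeff τ)]

instance (d : ℕ) : CommRing (A d) :=
  { (inferInstance : Ring (A d)) with
    mul_comm := fun a b => Subtype.ext (mul_comm_of_mem a.1 b.2) }

/-- The part `𝒜(d)_k` of norm `k`: the elements that are linear combinations of basis
elements `[σ]` with `N σ = k`. -/
def homogeneous (d k : ℕ) : Submodule ℚ (A d) where
  carrier := {f | ∀ σ : Perm (Fin d), f.1.coeff σ ≠ 0 → norm σ = k}
  zero_mem' := fun σ h => absurd rfl h
  add_mem' := by
    intro a b ha hb σ h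
    by_contra hk
    have h1 : a.1.coeff σ = 0 := by_contra fun h' => hk (ha σ h')
    have h2 : b.1.coeff σ = 0 := by_contra fun h' => hk (hb σ h')
    exact h (by simp [h1, h2])
  smul_mem' := by
    intro c a ha σ h
    exact ha σ fun h' => h (by simp [h'])

/-- The sum of all `[σ]` in `Gr d` such that the multiset of the lengths of the cycles of `σ`,
fixed points not counted, is `μ`. -/
def classSum (d : ℕ) (μ : Multiset ℕ) : A d :=
  ⟨∑ σ : Perm (Fin d) with σ.cycleType = μ, Gr.single σ, by
    have hc : ∀ ρ : Perm (Fin d),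
        (∑ σ : Perm (Fin d) with σ.cycleType = μ, Gr.single σ : Gr d).coeff ρ
          = if ρ.cycleType = μ then 1 else 0 := by
      intro ρ
      simp [Gr.coeff_sum, Gr.coeff_single]
    intro g σ
    rw [hc, hc, Perm.cycleType_conj]⟩

/-- `γ_i(d)`, for `i ≥ 2`: the sum of all `[σ]` where `σ` is an `i`-cycle. -/
def gam (d i : ℕ) : A d := classSum d {i}

/-- `δ_i(d)`: the sum of all `[σ]` where `σ` is a product of `i` disjoint transpositions. -/
def del (d i : ℕ) : A d := classSum d (Multiset.replicate i 2)

end SymGr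

end

/-! ### The norm, cycles and geodesic products. -/

noncomputable section

open Finset Equiv

namespace SymGr

variable {d : ℕ}

/-! The relation is checked one coefficient at a time. The norm of `σ` is the codimension of its
invariant functions (`finrank_invariants_add_norm`), so in a product `ρ = σ * τ` with additive norms
the cycles of both factors lie inside cycles of `ρ`. If `σ` is an involution and `τ` a cycle, `ρ`
therefore has one cycle of some length `r` and otherwise `k` transpositions. For `r ≥ 3` such
factorizations correspond to sets `M` of pairwise non-adjacent vertices of the `r`-gon: `M` consists
of the points of the long cycle where `σ` agrees with `ρ`. Hence (`coeff_del_mul_gam`) the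
coefficients of the products are the numbers `cycIndep r (s - k)`, up to sign the coefficients of a
Lucas polynomial.

The relation thus becomes an identity between Catalan numbers and Lucas polynomials,
`sum_catalan_mul_cycIndep`. It holds for `r ≥ 4` because the product of the Catalan series with a
Fibonacci polynomial has a gap in its coefficients. In `𝔖_{2m}` the cases `r = 2` and `r = 3` do not
occur: `r + k = m + 2` and `r + 2k ≤ 2m` give `r ≥ 4`.

For nontriviality, a triangular recursion writes `δ_{n+1}` as a combination of the products `δ_{n-j}
γ_{j+2}` (`exists_smul_del_eq_sum`), which yields the polynomials. Only the term `s = m` can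
contribute to `X_2^(m+1)`. A product of `m` disjoint transpositions exists in `𝔖_{2m}`, and among
the monomials in the `γ_i` only `γ_2^m` can reach it; so `X_2^m` must occur in any polynomial that
represents `δ_m` (`coeff_single_two_ne_zero`). -/

/-- The functions on `{1, …, d}` that are invariant under `σ`. -/
def invariants (σ : Perm (Fin d)) : Submodule ℚ (Fin d → ℚ) where
  carrier := {v | ∀ x, v (σ x) = v x}
  zero_mem' := fun _ => rfl
  add_mem' := fun ha hb x => by simp [ha x, hb x]
  smul_mem' := fun c v hv x => by simp [hv x]

theorem mem_invariants {σ : Perm (Fin d)} {v : Fin d → ℚ} : v ∈ invariants σ ↔ ∀ x, v (σ x) = v x := Iff.rfl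

theorem invariants_inf_le (σ τ : Perm (Fin d)) : invariants σ ⊓ invariants τ ≤ invariants (σ * τ) := fun v hv x => by
  rw [Perm.mul_apply, hv.1, hv.2]

theorem invariants_one : invariants (1 : Perm (Fin d)) = ⊤ := by
  ext v; simp [mem_invariants]

theorem finrank_invariants_one : Module.finrank ℚ (invariants (1 : Perm (Fin d))) = d := by
  rw [invariants_one]; simp

theorem finrank_invariants_add_le (σ τ : Perm (Fin d)) :
    Module.finrank ℚ (invariants σ) + Module.finrank ℚ (invariants τ) ≤
      Module.finrank ℚ ↥(invariants σ ⊓ invariants τ) + d := by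
  rw [← Submodule.finrank_sup_add_finrank_inf_eq, add_comm]
  have := Submodule.finrank_le (invariants σ ⊔ invariants τ)
  simp at this
  omega

theorem finrank_invariants_swap (x y : Fin d) : d ≤ Module.finrank ℚ (invariants (swap x y)) + 1 := by
  let φ : (Fin d → ℚ) →ₗ[ℚ] ℚ := LinearMap.proj (R := ℚ) (φ := fun _ => ℚ) x -
    LinearMap.proj (R := ℚ) (φ := fun _ => ℚ) y
  have h : LinearMap.ker φ ≤ invariants (swap x y) := by
    intro v hv z
    have hv' : v x = v y := sub_eq_zero.mp hv
    by_cases h1 : z = x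
    · subst h1; simp [hv']
    · by_cases h2 : z = y
      · subst h2; simp [hv']
      · rw [swap_apply_of_ne_of_ne h1 h2]
  have h1 := Submodule.finrank_mono h
  have h2 := LinearMap.finrank_range_add_finrank_ker φ
  have h3 := Submodule.finrank_le (LinearMap.range φ)
  simp at h2 h3
  omega

/-- Each transposition of a factorization lowers the dimension of the common invariants by at most
one. -/
theorem le_finrank_invariants_add_norm (σ : Perm (Fin d)) : d ≤ Module.finrank ℚ (invariants σ) + norm σ := by
  obtain ⟨l, h1, h2, h3⟩ := exists_list σ
  rw [← h1, ← h3]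
  clear h1 h3
  induction l with
  | nil => exact finrank_invariants_one.ge
  | cons g l ih =>
    obtain ⟨x, y, -, rfl⟩ := h2 g (by simp)
    have h4 := ih fun g hg => h2 g (by simp [hg])
    have h5 := finrank_invariants_swap x y
    have h6 := finrank_invariants_add_le (swap x y) l.prod
    have h7 := Submodule.finrank_mono (invariants_inf_le (swap x y) l.prod)
    change d ≤ Module.finrank ℚ (invariants (swap x y * l.prod)) + (l.length + 1)
    omega

/-- Multiplying by `swap x (σ x)` makes `x` a fixed point and enlarges the space of invariants, so
the codimension drops while the norm drops by at most one. -/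
theorem finrank_invariants_add_norm_le (σ : Perm (Fin d)) : Module.finrank ℚ (invariants σ) + norm σ ≤ d := by
  induction h : d - Module.finrank ℚ (invariants σ) using Nat.strong_induction_on generalizing σ with
  | _ n ih =>
    have hle (τ : Perm (Fin d)) : Module.finrank ℚ (invariants τ) ≤ d := by
      simpa using Submodule.finrank_le (invariants τ)
    by_cases h1 : σ = 1
    · subst h1
      exact (by rw [finrank_invariants_one, norm_one, add_zero])
    · obtain ⟨x, hx⟩ : ∃ x, σ x ≠ x := by
        by_contra! hc
        exact h1 (Equiv.ext hc)
      have hlt : invariants σ < invariants (swap x (σ x) * σ) := by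
        refine lt_of_le_of_ne (fun v hv z => ?_) fun he => ?_
        · have e : v x = v (σ x) := (hv x).symm
          rw [Perm.mul_apply]
          by_cases h2 : σ z = x
          · rw [h2, swap_apply_left, ← e, ← hv z, h2]
          · by_cases h3 : σ z = σ x
            · rw [h3, swap_apply_right, σ.injective h3]
            · rw [swap_apply_of_ne_of_ne h2 h3, hv z]
        -- The indicator of the new fixed point `x` shows that the inclusion is strict.
        · have hm : (Pi.single x 1 : Fin d → ℚ) ∈ invariants (swap x (σ x) * σ) := by
            intro z
            by_cases hz : z = x
            · subst hz; simp
            · rw [Pi.single_eq_of_ne hz, Pi.single_eq_of_ne]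
              intro h4
              rw [Perm.mul_apply, swap_apply_eq_iff, swap_apply_left] at h4
              exact hz (σ.injective h4)
          rw [← he] at hm
          have h5 := hm x
          rw [Pi.single_eq_of_ne hx] at h5
          simp at h5
      have hlt' := Submodule.finrank_lt_finrank_of_lt hlt
      have h6 := hle (swap x (σ x) * σ)
      have h7 := ih _ (by omega) (swap x (σ x) * σ) rfl
      have h8 : norm σ ≤ 1 + norm (swap x (σ x) * σ) := by
        have h9 := norm_mul_le (swap x (σ x)) (swap x (σ x) * σ)
        have h10 : norm (swap x (σ x)) ≤ 1 :=
          norm_le [swap x (σ x)] (by simpa using ⟨x, σ x, hx.symm, rfl⟩) (by simp)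
        rw [← mul_assoc, swap_mul_self, one_mul] at h9
        omega
      omega

theorem finrank_invariants_add_norm (σ : Perm (Fin d)) : Module.finrank ℚ (invariants σ) + norm σ = d :=
  le_antisymm (finrank_invariants_add_norm_le σ) (le_finrank_invariants_add_norm σ)

/-- The intersection has codimension at most `norm σ + norm τ`, which is here the codimension of the
larger space. -/
theorem invariants_mul_of_norm_mul {σ τ : Perm (Fin d)} (h : norm (σ * τ) = norm σ + norm τ) :
    invariants (σ * τ) = invariants σ ⊓ invariants τ := by
  refine (Submodule.eq_of_le_of_finrank_le (invariants_inf_le σ τ) ?_).symm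
  have h1 := finrank_invariants_add_le σ τ
  have h2 := finrank_invariants_add_norm σ
  have h3 := finrank_invariants_add_norm τ
  have h4 := finrank_invariants_add_norm (σ * τ)
  omega

/-- Test the inclusion on the indicator function of the `ρ`-cycle of `x`. -/
theorem sameCycle_of_invariants_le {ρ σ : Perm (Fin d)} (h : invariants ρ ≤ invariants σ)
    (x : Fin d) : ρ.SameCycle x (σ x) := by
  classical
  have h1 : (fun y => if ρ.SameCycle x y then (1 : ℚ) else 0) ∈ invariants ρ := fun y => by
    simp only [Perm.sameCycle_apply_right]
  have h2 := h h1 x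
  by_contra hc
  simp only [hc, if_false, Perm.SameCycle.refl ρ x, if_true] at h2
  exact zero_ne_one h2

theorem sameCycle_right {σ τ : Perm (Fin d)} (h : norm (σ * τ) = norm σ + norm τ) (x : Fin d) :
    (σ * τ).SameCycle x (τ x) :=
  sameCycle_of_invariants_le ((invariants_mul_of_norm_mul h).trans_le inf_le_right) x

theorem sameCycle_mono {ρ σ : Perm (Fin d)} (h : ∀ x, ρ.SameCycle x (σ x)) {x y : Fin d}
    (hxy : σ.SameCycle x y) : ρ.SameCycle x y := by
  obtain ⟨n, rfl⟩ := hxy.exists_nat_pow_eq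
  induction n with
  | zero => exact Perm.SameCycle.refl _ _
  | succ n ih =>
    rw [pow_succ', Perm.mul_apply]
    exact (ih ⟨n, by simp⟩).trans (h _)

theorem norm_mul_of_disjoint {σ τ : Perm (Fin d)} (h : σ.Disjoint τ) :
    norm (σ * τ) = norm σ + norm τ := by
  have h1 : invariants (σ * τ) ≤ invariants σ ⊓ invariants τ := by
    refine fun v hv => ⟨fun x => ?_, fun x => ?_⟩
    · rcases h x with h2 | h2
      · rw [h2]
      · have := hv x
        rwa [Perm.mul_apply, h2] at this
    · rcases h x with h2 | h2
      · have := hv x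
        rw [h.commute.eq, Perm.mul_apply, h2] at this
        exact this
      · rw [h2]
  have h2 : invariants σ ⊔ invariants τ = ⊤ := by
    refine eq_top_iff.mpr fun v _ => ?_
    -- The first part lives on the fixed points of `σ`, the second on points moved by `σ`, which `τ`
    -- fixes.
    have e : v = (fun x => if σ x = x then v x else 0) + fun x => if σ x = x then 0 else v x := by
      ext x
      by_cases hx : σ x = x <;> simp [hx]
    rw [e]
    refine Submodule.add_mem_sup (fun x => ?_) fun x => ?_
    · by_cases hx : σ x = x
      · simp [hx]
      · simp [hx]
    · rcases h x with h3 | h3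
      · have h4 : σ (τ x) = τ x := by
          rw [← Perm.mul_apply, h.commute.eq, Perm.mul_apply, h3]
        simp [h3, h4]
      · simp [h3]
  have h3 := Submodule.finrank_sup_add_finrank_inf_eq (invariants σ) (invariants τ)
  rw [h2, finrank_top, Module.finrank_fin_fun] at h3
  have h4 := Submodule.finrank_mono h1
  have h5 := finrank_invariants_add_norm σ
  have h6 := finrank_invariants_add_norm τ
  have h7 := finrank_invariants_add_norm (σ * τ)
  have h8 := norm_mul_le σ τ
  omega

/-- The invariants are the kernel of the surjective map `v ↦ (v y - v x)`, with `y` running over the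
support minus a base point `x`. -/
theorem norm_of_isCycle {σ : Perm (Fin d)} (h : σ.IsCycle) : norm σ + 1 = #σ.support := by
  obtain ⟨x, hx, -⟩ := id h
  let φ : (Fin d → ℚ) →ₗ[ℚ] (σ.support.erase x → ℚ) :=
    LinearMap.pi fun y =>
    LinearMap.proj (R := ℚ) (φ := fun _ => ℚ) (y : Fin d) -
      LinearMap.proj (R := ℚ) (φ := fun _ => ℚ) x
  have hker : LinearMap.ker φ = invariants σ := by
    ext v
    constructor
    · intro hv y
      have hv' : ∀ z ∈ σ.support, v z = v x := fun z hz => by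
        by_cases hzx : z = x
        · rw [hzx]
        · exact sub_eq_zero.mp (congrFun hv ⟨z, mem_erase.mpr ⟨hzx, hz⟩⟩)
      by_cases hy : y ∈ σ.support
      · rw [hv' y hy, hv' _ (Perm.apply_mem_support.mpr hy)]
      · rw [Perm.notMem_support.mp hy]
    · intro hv
      ext ⟨y, hy⟩
      obtain ⟨n, rfl⟩ :=
        (h.sameCycle hx (Perm.mem_support.mp (mem_erase.mp hy).2)).exists_nat_pow_eq
      refine sub_eq_zero.mpr ?_
      change v ((σ ^ n) x) = v x
      clear hy
      induction n with
      | zero => simp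
      | succ n ih => rw [pow_succ', Perm.mul_apply, hv, ih]
  have hrange : LinearMap.range φ = ⊤ := by
    refine LinearMap.range_eq_top.mpr fun w =>
      ⟨fun y => if hy : y ∈ σ.support.erase x then w ⟨y, hy⟩ else 0, ?_⟩
    ext ⟨y, hy⟩
    simp [φ, (mem_erase.mp hy).1, Perm.mem_support.mp (mem_erase.mp hy).2]
  have h1 := LinearMap.finrank_range_add_finrank_ker φ
  have hx' : x ∈ σ.support := Perm.mem_support.mpr hx
  rw [hker, hrange, finrank_top, Module.finrank_fin_fun, Module.finrank_fintype_fun_eq_card,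
    Fintype.card_coe, card_erase_of_mem hx'] at h1
  have h2 := finrank_invariants_add_norm σ
  have h3 := card_pos.mpr ⟨x, hx'⟩
  omega

theorem norm_add_card_cycleType (σ : Perm (Fin d)) :
    norm σ + Multiset.card σ.cycleType = σ.cycleType.sum := by
  induction σ using Perm.cycle_induction_on with
  | base_one => simp [norm_one]
  | base_cycles σ h => simp [h.cycleType, norm_of_isCycle h]
  | induction_disjoint σ τ h _ h1 h2 =>
    rw [norm_mul_of_disjoint h, h.cycleType_mul, Multiset.card_add, Multiset.sum_add]
    omega

theorem norm_of_cycleType_replicate {σ : Perm (Fin d)} {s : ℕ}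
    (h : σ.cycleType = Multiset.replicate s 2) : norm σ = s := by
  have := norm_add_card_cycleType σ
  simp [h] at this
  omega

theorem norm_of_cycleType_singleton {σ : Perm (Fin d)} {p : ℕ}
    (h : σ.cycleType = {p}) : norm σ + 1 = p := by
  simpa [h] using norm_add_card_cycleType σ

theorem norm_of_cycleType_cons {ρ : Perm (Fin d)} {r k : ℕ}
    (h : ρ.cycleType = r ::ₘ Multiset.replicate k 2) : norm ρ + 1 = r + k := by
  have := norm_add_card_cycleType ρ
  simp [h] at this
  omega

theorem apply_apply_of_cycleType_replicate {σ : Perm (Fin d)} {s : ℕ}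
    (h : σ.cycleType = Multiset.replicate s 2) (x : Fin d) : σ (σ x) = x := by
  have h1 : orderOf σ ∣ 2 := by
    rw [← Perm.lcm_cycleType, h, Multiset.lcm_dvd]
    intro b hb
    rw [Multiset.eq_of_mem_replicate hb]
  have h2 := orderOf_dvd_iff_pow_eq_one.mp h1
  rw [pow_two] at h2
  rw [← Perm.mul_apply, h2, Perm.one_apply]

theorem cycleType_of_involutive {σ : Perm (Fin d)} (h : ∀ x, σ (σ x) = x) :
    ∃ s, σ.cycleType = Multiset.replicate s 2 := by
  have h1 : σ ^ 2 = 1 := by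
    ext x
    simp [pow_two, h]
  refine ⟨_, Multiset.eq_replicate_card.mpr fun b hb => ?_⟩
  have h2 := Perm.two_le_of_mem_cycleType hb
  have h3 := Nat.le_of_dvd two_pos
    ((Perm.dvd_of_mem_cycleType hb).trans (orderOf_dvd_iff_pow_eq_one.mpr h1))
  omega

theorem cycleType_eq_singleton_iff {σ : Perm (Fin d)} {p : ℕ} :
    σ.cycleType = {p} ↔ σ.IsCycle ∧ #σ.support = p := by
  constructor
  · intro h
    refine ⟨Perm.card_cycleType_eq_one.mp (by simp [h]), ?_⟩
    rw [← Perm.sum_cycleType, h, Multiset.sum_singleton]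
  · rintro ⟨h, rfl⟩
    exact h.cycleType

end SymGr

end

/-! ### Catalan numbers, Lucas polynomials and independent sets of a cycle. -/

noncomputable section

open Finset

namespace SymGr

open PowerSeries

/-- The Fibonacci polynomials `F_{n+2} = F_{n+1} - X F_n`, as power series. -/
def fibSeries : ℕ → ℚ⟦X⟧
  | 0 => 0
  | 1 => 1
  | n + 2 => fibSeries (n + 1) - X * fibSeries n

/-- The Lucas polynomials of positive index, as power series. -/
def lucSeries (n : ℕ) : ℚ⟦X⟧ := fibSeries (n + 1) - X * fibSeries (n - 1)

theorem fibSeries_add_two (n : ℕ) :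
    fibSeries (n + 2) = fibSeries (n + 1) - X * fibSeries n := by rw [fibSeries]

/-- The Catalan generating function with rational coefficients. -/
def catSeries : ℚ⟦X⟧ := PowerSeries.mk fun n => (catalan n : ℚ)

theorem coeff_catSeries (n : ℕ) : coeff n catSeries = (catalan n : ℚ) := coeff_mk _ _

theorem catSeries_eq : catSeries = 1 + X * catSeries ^ 2 := by
  have h := congrArg (PowerSeries.map (Nat.castRingHom ℚ)) catalanSeries_sq_mul_X_add_one
  have e : PowerSeries.map (Nat.castRingHom ℚ) catalanSeries = catSeries := by
    ext n
    simp [coeff_catSeries]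
  simp only [map_add, map_mul, map_pow, map_one, map_X, e] at h
  linear_combination -h

/-- The quotients `F_n / F_{n+1}` are the convergents of the continued fraction of the Catalan
series `C = 1 / (1 - X C)`; this is the exact error term. -/
theorem catSeries_mul_fibSeries_succ (n : ℕ) :
    catSeries * fibSeries (n + 1) = fibSeries n + X ^ n * catSeries ^ (n + 1) := by
  induction n using Nat.twoStepInduction with
  | zero => simp [fibSeries]
  | one =>
    rw [fibSeries_add_two]
    simp only [fibSeries]
    linear_combination catSeries_eq
  | more n h1 h2 =>
    have e : fibSeries (n + 1 + 1) = fibSeries (n + 1) - X * fibSeries n := fibSeries_add_two n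
    rw [e] at h2
    rw [fibSeries_add_two (n + 1), e]
    linear_combination h2 - X * h1 + X ^ (n + 1) * catSeries ^ (n + 1) * catSeries_eq

theorem coeff_fibSeries_eq_zero (n : ℕ) : ∀ N, n ≤ 2 * N → coeff N (fibSeries n) = 0 := by
  induction n using Nat.twoStepInduction with
  | zero => simp [fibSeries]
  | one =>
    intro N hN
    rw [fibSeries, coeff_one, if_neg (by omega)]
  | more n h1 h2 =>
    intro N hN
    obtain ⟨N, rfl⟩ : ∃ N', N = N' + 1 := ⟨N - 1, by omega⟩
    rw [fibSeries_add_two, map_sub, coeff_succ_X_mul, h2 _ (by omega), h1 _ (by omega), sub_zero]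

/-- The gap: `F_n` has degree below `n / 2`, and the error term starts only at `X ^ n`. -/
theorem coeff_catSeries_mul_fibSeries_eq_zero {n N : ℕ} (h : N < n) (h' : n ≤ 2 * N) :
    coeff N (catSeries * fibSeries (n + 1)) = 0 := by
  rw [catSeries_mul_fibSeries_succ, map_add, coeff_fibSeries_eq_zero n N h', zero_add,
    coeff_X_pow_mul', if_neg (by omega)]

/-- Both Fibonacci pieces of the Lucas polynomial hit the gap once `r ≥ 4`. For `r = 3` the
coefficient is `-2`. -/
theorem coeff_catSeries_mul_lucSeries_eq_zero {r : ℕ} (hr : 4 ≤ r) :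
    coeff (r - 2) (catSeries * lucSeries r) = 0 := by
  obtain ⟨q, rfl⟩ : ∃ q, r = q + 3 := ⟨r - 3, by omega⟩
  have h1 := coeff_catSeries_mul_fibSeries_eq_zero (n := q + 3) (N := q + 1) (by omega) (by omega)
  have h2 := coeff_catSeries_mul_fibSeries_eq_zero (n := q + 1) (N := q) (by omega) (by omega)
  have e : catSeries * lucSeries (q + 3) =
      catSeries * fibSeries (q + 3 + 1) - X * (catSeries * fibSeries (q + 1 + 1)) := by
    rw [lucSeries, show q + 3 - 1 = q + 1 + 1 by omega]
    ring
  rw [e, map_sub, show q + 3 - 2 = q + 1 by omega, coeff_succ_X_mul, h1, h2, sub_zero]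

theorem lucSeries_add_two (n : ℕ) (hn : 1 ≤ n) :
    lucSeries (n + 2) = lucSeries (n + 1) - X * lucSeries n := by
  obtain ⟨q, rfl⟩ : ∃ q, n = q + 1 := ⟨n - 1, by omega⟩
  simp only [lucSeries, Nat.add_sub_cancel]
  have e1 : fibSeries (q + 1 + 2 + 1) = fibSeries (q + 1 + 1 + 1) - X * fibSeries (q + 1 + 1) :=
    fibSeries_add_two (q + 2)
  have e2 : fibSeries (q + 1 + 1) = fibSeries (q + 1) - X * fibSeries q := fibSeries_add_two q
  rw [show q + 1 + 2 - 1 = q + 1 + 1 by omega, e1, e2]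
  ring

/-- The factor `s` in the relation acts as `X d/dX` on the Lucas polynomial; since the derivative is
again a Fibonacci polynomial, the gap applies to it too. -/
theorem derivative_lucSeries (n : ℕ) :
    derivative ℚ (lucSeries (n + 1)) = -((n + 1 : ℕ) : ℚ⟦X⟧) * fibSeries n := by
  induction n using Nat.twoStepInduction with
  | zero => simp [lucSeries, fibSeries]
  | one => simp [lucSeries, fibSeries]; norm_num
  | more n h1 h2 =>
    rw [lucSeries_add_two (n + 1) (by omega), map_sub, Derivation.leibniz, h1, h2,
      derivative_X, lucSeries, Nat.add_sub_cancel, fibSeries_add_two n]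
    simp only [smul_eq_mul]
    push_cast
    ring

theorem coeff_catSeries_mul_derivative_eq_zero {r : ℕ} (hr : 4 ≤ r) :
    coeff (r - 2) (catSeries * (X * derivative ℚ (lucSeries r))) = 0 := by
  obtain ⟨q, rfl⟩ : ∃ q, r = q + 3 := ⟨r - 3, by omega⟩
  have h2 := coeff_catSeries_mul_fibSeries_eq_zero (n := q + 1) (N := q) (by omega) (by omega)
  have e : catSeries * (X * derivative ℚ (lucSeries (q + 3))) =
      (-((q : ℚ) + 3)) • (X * (catSeries * fibSeries (q + 1 + 1))) := by
    have e3 : (C ((q : ℚ) + 3) : ℚ⟦X⟧) = ((q + 2 + 1 : ℕ) : ℚ⟦X⟧) := by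
      rw [← map_natCast (C (R := ℚ))]
      push_cast
      congr 1
      ring
    rw [derivative_lucSeries (q + 2), smul_eq_C_mul, map_neg, e3]
    ring
  rw [e, show q + 3 - 2 = q + 1 by omega, map_smul, coeff_succ_X_mul, h2, smul_zero]

/-- The number of `j`-element sets of vertices of a cycle with `r` vertices, no two adjacent. -/
def cycIndep (r j : ℕ) : ℚ := (-1) ^ j * coeff j (lucSeries r)

/-- The factor `k + j` splits the sum into `k` times the vanishing coefficient for `lucSeries r` and
the one for `X` times its derivative. -/
theorem sum_catalan_mul_cycIndep {r : ℕ} (hr : 4 ≤ r) (k : ℕ) :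
    ∑ j ∈ range (r - 1), (-1 : ℚ) ^ (k + j) * ((k + j : ℕ) : ℚ) *
      (catalan (r - 2 - j) : ℚ) * cycIndep r j = 0 := by
  have h1 := coeff_catSeries_mul_lucSeries_eq_zero hr
  have h2 := coeff_catSeries_mul_derivative_eq_zero hr
  rw [mul_comm, coeff_mul, Nat.sum_antidiagonal_eq_sum_range_succ
    (fun i j => coeff i (lucSeries r) * coeff j catSeries)] at h1
  rw [mul_comm, coeff_mul, Nat.sum_antidiagonal_eq_sum_range_succ
    (fun i j => coeff i (X * derivative ℚ (lucSeries r)) * coeff j catSeries)] at h2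
  have hX (f : ℚ⟦X⟧) (i : ℕ) : coeff i (X * derivative ℚ f) = i * coeff i f := by
    cases i with
    | zero => simp
    | succ i =>
      rw [coeff_succ_X_mul, coeff_derivative]
      push_cast
      ring
  simp only [hX, coeff_catSeries] at h1 h2
  rw [show r - 1 = (r - 2).succ by omega]
  calc _ = (-1 : ℚ) ^ k * (k * ∑ j ∈ range (r - 2).succ,
          coeff j (lucSeries r) * (catalan (r - 2 - j) : ℚ) +
        ∑ j ∈ range (r - 2).succ,
          j * coeff j (lucSeries r) * (catalan (r - 2 - j) : ℚ)) := by
        rw [mul_sum, ← sum_add_distrib, mul_sum]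
        refine sum_congr rfl fun j _ => ?_
        have hs : (-1 : ℚ) ^ j * (-1) ^ j = 1 := by rw [← mul_pow]; simp
        rw [cycIndep, pow_add]
        push_cast
        linear_combination ((-1 : ℚ) ^ k * (k + j) * (catalan (r - 2 - j) : ℚ) *
          coeff j (lucSeries r)) * hs
    _ = 0 := by rw [h1, h2]; simp

theorem cycIndep_zero {r : ℕ} : cycIndep r 0 = 1 := by
  have h (n : ℕ) : coeff 0 (fibSeries (n + 1)) = 1 := by
    induction n with
    | zero => simp [fibSeries]
    | succ n ih => simpa [fibSeries_add_two] using ih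
  have := h r
  simp [cycIndep, lucSeries] at this ⊢
  exact this

/-! ### Counting independent sets -/

/-- Split by whether the last vertex belongs to the set; if it does, its neighbour does not. -/
theorem sum_path (n : ℕ) :
    ∑ S ∈ (range n).powerset with ∀ i ∈ S, i + 1 ∉ S, (-X : ℚ⟦X⟧) ^ #S = fibSeries (n + 2) := by
  induction n using Nat.twoStepInduction with
  | zero => simp [fibSeries, Finset.filter_singleton]
  | one =>
    rw [range_one, sum_filter, ← insert_empty_eq, sum_powerset_insert (by simp)]
    simp [fibSeries]
    ring
  | more n h1 h2 =>
    rw [sum_filter, range_add_one, sum_powerset_insert (by simp), ← sum_filter, h2,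
      fibSeries_add_two (n + 2), ← h1, sub_eq_add_neg]
    congr 1
    rw [range_add_one, sum_powerset_insert (by simp), sum_filter, ← neg_mul, mul_sum]
    rw [sum_eq_zero (s := (range n).powerset)
      (f := fun S => if ∀ i ∈ insert (n + 1) (insert n S), i + 1 ∉ insert (n + 1) (insert n S)
        then (-X : ℚ⟦X⟧) ^ #(insert (n + 1) (insert n S)) else 0), add_zero]
    · refine sum_congr rfl fun S hS => ?_
      rw [mem_powerset] at hS
      have h3 : ∀ i ∈ S, i < n := fun i hi => mem_range.mp (hS hi)
      have h4 : n + 1 ∉ S := fun h => by have := h3 _ h; omega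
      have h5 : (∀ i ∈ insert (n + 1) S, i + 1 ∉ insert (n + 1) S) ↔ ∀ i ∈ S, i + 1 ∉ S := by
        constructor
        · intro h i hi hi'
          exact h i (mem_insert_of_mem hi) (mem_insert_of_mem hi')
        · intro h i hi hi'
          rcases mem_insert.mp hi with rfl | hi <;> rcases mem_insert.mp hi' with hi' | hi'
          · omega
          · have := h3 _ hi'; omega
          · have := h3 _ hi; omega
          · exact h i hi hi'
      simp only [h5, card_insert_of_notMem h4, pow_succ', mul_ite, mul_zero]
    · intro S _
      rw [if_neg]
      intro h
      exact h n (by simp) (by simp)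

/-- Without the vertex `q + 2` a path on `q + 2` vertices remains. With it, both its neighbours `0`
and `q + 1` are excluded, which leaves the path `1, …, q`. -/
theorem sum_cycle (q : ℕ) :
    ∑ S ∈ (range (q + 3)).powerset with (∀ i ∈ S, i + 1 ∉ S) ∧ ¬(0 ∈ S ∧ q + 2 ∈ S),
      (-X : ℚ⟦X⟧) ^ #S = lucSeries (q + 3) := by
  rw [sum_filter, range_add_one, sum_powerset_insert (by simp), lucSeries, sub_eq_add_neg]
  congr 1
  · rw [← sum_path (q + 2), sum_filter]
    refine sum_congr rfl fun S hS => ?_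
    have h : q + 2 ∉ S := fun h => by simpa using mem_powerset.mp hS h
    simp [h]
  · rw [show q + 3 - 1 = q + 2 by omega, ← sum_path q, ← neg_mul, mul_sum, ← sum_filter]
    symm
    refine sum_bij (fun S _ => S.map (addRightEmbedding 1)) ?_ ?_ ?_ ?_
    · intro S hS
      simp only [mem_filter, mem_powerset] at hS ⊢
      have h3 : ∀ i ∈ S, i < q := fun i hi => mem_range.mp (hS.1 hi)
      refine ⟨?_, ?_, ?_⟩
      · intro i hi
        obtain ⟨j, hj, rfl⟩ := mem_map.mp hi
        have := h3 j hj
        simp; omega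
      · intro i hi hi'
        simp only [mem_insert, mem_map, addRightEmbedding_apply] at hi hi'
        rcases hi with rfl | ⟨a, ha, rfl⟩ <;> rcases hi' with hi' | ⟨b, hb, hb'⟩
        · omega
        · have := h3 b hb; omega
        · have := h3 a ha; omega
        · obtain rfl : b = a + 1 := by omega
          exact hS.2 a ha hb
      · simp
    · intro S _ T _ h
      exact map_injective _ h
    · intro S hS
      simp only [mem_filter, mem_powerset] at hS
      obtain ⟨h1, h2, h3⟩ := hS
      have h0 : 0 ∉ S := fun h => h3 ⟨mem_insert_of_mem h, mem_insert_self _ _⟩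
      have hq : q + 1 ∉ S := fun h => h2 _ (mem_insert_of_mem h) (mem_insert_self _ _)
      refine ⟨(range q).filter fun i => i + 1 ∈ S, ?_, ?_⟩
      · simp only [mem_filter, mem_powerset, filter_subset, true_and]
        intro i hi hi'
        exact h2 _ (mem_insert_of_mem hi.2) (mem_insert_of_mem hi'.2)
      · ext i
        simp only [mem_map, mem_filter, mem_range, addRightEmbedding_apply]
        constructor
        · rintro ⟨j, ⟨_, hj⟩, rfl⟩
          exact hj
        · intro hi
          have h4 := mem_range.mp (h1 hi)
          have h5 : i ≠ 0 := fun h => h0 (h ▸ hi)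
          have h6 : i ≠ q + 1 := fun h => hq (h ▸ hi)
          exact ⟨i - 1, ⟨by omega, by rwa [Nat.sub_add_cancel (by omega)]⟩, by omega⟩
    · intro S hS
      simp only [mem_filter, mem_powerset] at hS
      have h4 : q + 2 ∉ S.map (addRightEmbedding 1) := by
        simp only [mem_map, addRightEmbedding_apply, not_exists, not_and]
        intro a ha h
        have := mem_range.mp (hS.1 ha)
        omega
      rw [card_insert_of_notMem h4, card_map, pow_succ']

open Equiv

/-- The labelling `i ↦ (ρ ^ i) x` of `S` turns adjacency under `ρ` into adjacency on the standard
cycle. -/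
theorem sum_indep_of_isCycleOn {α : Type*} [DecidableEq α] {ρ : Perm α} {S : Finset α}
    (h : ρ.IsCycleOn S) (hS : 3 ≤ #S) :
    ∑ M ∈ S.powerset with ∀ x ∈ M, ρ x ∉ M, (-X : ℚ⟦X⟧) ^ #M = lucSeries #S := by
  obtain ⟨q, hq⟩ : ∃ q, #S = q + 3 := ⟨#S - 3, by omega⟩
  obtain ⟨x, hx⟩ := card_pos.mp (by omega : 0 < #S)
  have hinj (i j : ℕ) (hi : i < q + 3) (hj : j < q + 3) (e : (ρ ^ i) x = (ρ ^ j) x) : i = j := by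
    rw [h.pow_apply_eq_pow_apply hx, hq] at e
    exact Nat.ModEq.eq_of_lt_of_lt e hi hj
  have hinj' : Set.InjOn (fun i => (ρ ^ i) x) (range (q + 3)) := fun i hi j hj e =>
    hinj i j (by simpa using hi) (by simpa using hj) e
  have himg : (range (q + 3)).image (fun i => (ρ ^ i) x) = S := by
    ext y
    simp only [mem_image, mem_range]
    constructor
    · rintro ⟨i, -, rfl⟩
      exact ((h.1.iterate i).mapsTo hx)
    · intro hy
      obtain ⟨n, hn, e⟩ := h.exists_pow_eq hx hy
      exact ⟨n, hq ▸ hn, e⟩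
  have hmem {T : Finset ℕ} (hT : T ⊆ range (q + 3)) {i : ℕ} (hi : i < q + 3) :
      (ρ ^ i) x ∈ T.image (fun i => (ρ ^ i) x) ↔ i ∈ T := by
    rw [mem_image]
    constructor
    · rintro ⟨j, hj, e⟩
      rwa [← hinj j i (mem_range.mp (hT hj)) hi e]
    · exact fun hi => ⟨i, hi, rfl⟩
  rw [hq, ← sum_cycle]
  symm
  refine sum_bij (fun T _ => T.image fun i => (ρ ^ i) x) ?_ ?_ ?_ ?_
  · intro T hT
    simp only [mem_filter, mem_powerset] at hT ⊢
    obtain ⟨h1, h2, h3⟩ := hT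
    refine ⟨himg ▸ image_subset_image h1, ?_⟩
    intro y hy hy'
    obtain ⟨i, hi, rfl⟩ := mem_image.mp hy
    have h4 := mem_range.mp (h1 hi)
    rw [← Perm.mul_apply, ← pow_succ'] at hy'
    -- At the last label the successor wraps around to `0`.
    by_cases h5 : i = q + 2
    · subst h5
      have h6 : (ρ ^ (q + 2 + 1)) x = (ρ ^ 0) x := by
        have := h.pow_card_apply hx
        rw [hq] at this
        simpa using this
      rw [h6, hmem h1 (by omega)] at hy'
      exact h3 ⟨hy', hi⟩
    · rw [hmem h1 (by omega)] at hy'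
      exact h2 i hi hy'
  · intro T hT T' hT' e
    simp only [mem_filter, mem_powerset] at hT hT'
    ext i
    constructor <;> intro hi
    · rw [← hmem hT'.1 (mem_range.mp (hT.1 hi)), ← e]
      exact mem_image_of_mem _ hi
    · rw [← hmem hT.1 (mem_range.mp (hT'.1 hi)), e]
      exact mem_image_of_mem _ hi
  · intro M hM
    simp only [mem_filter, mem_powerset] at hM
    obtain ⟨T, hT, rfl⟩ := subset_image_iff.mp (himg.symm ▸ hM.1)
    have hT : T ⊆ range (q + 3) := by simpa using hT
    refine ⟨T, ?_, rfl⟩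
    simp only [mem_filter, mem_powerset]
    refine ⟨hT, fun i hi hi' => ?_, fun ⟨h1, h2⟩ => ?_⟩
    · refine hM.2 _ (mem_image_of_mem _ hi) ?_
      rw [← Perm.mul_apply, ← pow_succ']
      exact mem_image_of_mem (fun i => (ρ ^ i) x) hi'
    · refine hM.2 _ (mem_image_of_mem _ h2) ?_
      rw [← Perm.mul_apply, ← pow_succ']
      have := h.pow_card_apply hx
      rw [hq] at this
      rw [this]
      exact mem_image.mpr ⟨0, h1, by simp⟩
  · intro T hT
    simp only [mem_filter, mem_powerset] at hT
    rw [card_image_of_injOn (hinj'.mono (by exact_mod_cast hT.1))]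

theorem card_indep_of_isCycleOn {α : Type*} [DecidableEq α] {ρ : Perm α} {S : Finset α}
    (h : ρ.IsCycleOn S) (hS : 3 ≤ #S) (j : ℕ) :
    (#{M ∈ S.powerset | #M = j ∧ ∀ x ∈ M, ρ x ∉ M} : ℚ) = cycIndep #S j := by
  have hs : (-1 : ℚ) ^ j * (-1) ^ j = 1 := by rw [← mul_pow]; simp
  rw [cycIndep, ← sum_indep_of_isCycleOn h hS, map_sum]
  have e (n : ℕ) : coeff j ((-X : ℚ⟦X⟧) ^ n) = if n = j then (-1) ^ j else 0 := by
    rw [neg_pow, ← map_one (C (R := ℚ)), ← map_neg, ← map_pow, coeff_C_mul, coeff_X_pow]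
    by_cases hn : n = j
    · simp [hn]
    · simp [hn, Ne.symm hn]
  simp only [e]
  rw [← sum_filter, filter_filter, sum_const, nsmul_eq_mul, mul_left_comm, hs, mul_one]
  simp [and_comm]

end SymGr

end

/-! ### Geodesic factorizations into an involution and a cycle. -/

noncomputable section

open Finset Equiv

namespace SymGr

variable {d : ℕ}

theorem coeff_classSum (μ : Multiset ℕ) (ρ : Perm (Fin d)) :
    (classSum d μ).1.coeff ρ = if ρ.cycleType = μ then 1 else 0 := by
  simp [classSum, Gr.coeff_sum, Gr.coeff_single]

theorem exists_of_coeff_mul_ne_zero {f g : Gr d} {ρ : Perm (Fin d)} (h : (f * g).coeff ρ ≠ 0) :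
    ∃ σ τ, σ * τ = ρ ∧ norm (σ * τ) = norm σ + norm τ ∧ f.coeff σ ≠ 0 ∧ g.coeff τ ≠ 0 := by
  rw [Gr.coeff_mul] at h
  obtain ⟨σ, -, h1⟩ := exists_ne_zero_of_sum_ne_zero h
  obtain ⟨τ, -, h2⟩ := exists_ne_zero_of_sum_ne_zero h1
  have h3 := (ite_ne_right_iff.mp h2)
  exact ⟨σ, τ, h3.1.1, h3.1.2, left_ne_zero_of_mul h3.2, right_ne_zero_of_mul h3.2⟩

theorem coeff_classSum_mul (μ ν : Multiset ℕ) (ρ : Perm (Fin d)) :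
    (classSum d μ * classSum d ν).1.coeff ρ =
      #{σ : Perm (Fin d) | norm ρ = norm σ + norm (σ⁻¹ * ρ) ∧ σ.cycleType = μ ∧
        (σ⁻¹ * ρ).cycleType = ν} := by
  change ((classSum d μ).1 * (classSum d ν).1).coeff ρ = _
  rw [Gr.coeff_mul, card_filter, Nat.cast_sum]
  refine sum_congr rfl fun σ _ => ?_
  rw [sum_eq_single (σ⁻¹ * ρ)]
  · simp only [coeff_classSum, mul_inv_cancel_left, true_and]
    by_cases h1 : norm ρ = norm σ + norm (σ⁻¹ * ρ) <;> by_cases h2 : σ.cycleType = μ <;>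
      by_cases h3 : (σ⁻¹ * ρ).cycleType = ν <;> simp [h1, h2, h3]
  · intro τ _ hτ
    rw [if_neg]
    rintro ⟨rfl, -⟩
    exact hτ (by simp)
  · simp

/-- In a geodesic factorization of `ρ` whose second factor is a cycle, that cycle moves only points
of one cycle of `ρ`. -/
theorem apply_eq_self_of_not_sameCycle {σ τ : Perm (Fin d)}
    (h : norm (σ * τ) = norm σ + norm τ) (hτ : τ.IsCycle) {x y : Fin d} (hx : τ x ≠ x)
    (hy : ¬(σ * τ).SameCycle x y) : τ y = y := by
  by_contra hc
  exact hy (sameCycle_mono (sameCycle_right h) (hτ.sameCycle hx hc))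

/-- The cycle `τ` stays inside one cycle `c` of the product; elsewhere the product agrees with `σ`,
so removing `c` leaves an involution. -/
theorem cycleType_of_involutive_mul_isCycle {σ τ : Perm (Fin d)}
    (h : norm (σ * τ) = norm σ + norm τ) (hσ : ∀ x, σ (σ x) = x) (hτ : τ.IsCycle) :
    ∃ r k, 2 ≤ r ∧ (σ * τ).cycleType = r ::ₘ Multiset.replicate k 2 := by
  obtain ⟨x, hx, -⟩ := id hτ
  set ρ := σ * τ with hρ
  have hρx : ρ x ≠ x := fun he => hx <| by
    have h1 : ρ.SameCycle x (τ x) := sameCycle_right h x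
    obtain ⟨n, hn⟩ := h1
    rw [Perm.zpow_apply_eq_self_of_apply_eq_self he] at hn
    exact hn.symm
  have hmem : ρ.cycleOf x ∈ ρ.cycleFactorsFinset :=
    Perm.cycleOf_mem_cycleFactorsFinset_iff.mpr (Perm.mem_support.mpr hρx)
  have hcyc : (ρ.cycleOf x).IsCycle := Perm.isCycle_cycleOf ρ hρx
  have hdis := Perm.disjoint_mul_inv_of_mem_cycleFactorsFinset hmem
  set c := ρ.cycleOf x with hc
  have hinv (y : Fin d) : (ρ * c⁻¹) ((ρ * c⁻¹) y) = y := by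
    rcases hdis y with h1 | h1
    · rw [h1, h1]
    · have hns : ∀ z, c z = z → ¬ρ.SameCycle x z ∧ (ρ * c⁻¹) z = σ z := fun z hz => by
        have h2 : ¬ρ.SameCycle x z := fun h2 => by
          have h3 : z ∈ c.support := by
            rw [hc, Perm.mem_support_cycleOf_iff' hρx]
            exact h2
          exact Perm.mem_support.mp h3 hz
        refine ⟨h2, ?_⟩
        rw [Perm.mul_apply, Perm.inv_eq_iff_eq.mpr hz.symm, hρ, Perm.mul_apply,
          apply_eq_self_of_not_sameCycle h hτ hx h2]
      have h4 : c ((ρ * c⁻¹) y) = (ρ * c⁻¹) y := by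
        rw [← Perm.mul_apply, ← hdis.commute.eq, Perm.mul_apply, h1]
      rw [(hns _ h4).2, (hns _ h1).2, hσ]
  obtain ⟨k, hk⟩ := cycleType_of_involutive hinv
  refine ⟨#c.support, k, hcyc.two_le_card_support, ?_⟩
  have h5 : ρ = ρ * c⁻¹ * c := by group
  rw [h5, hdis.cycleType_mul, hk, hcyc.cycleType, add_comm]
  rfl

theorem exists_isCycleOn {ρ : Perm (Fin d)} {r k : ℕ}
    (h : ρ.cycleType = r ::ₘ Multiset.replicate k 2) :
    ∃ S : Finset (Fin d), #S = r ∧ ρ.IsCycleOn S ∧ ∀ x ∉ S, ρ (ρ x) = x := by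
  have hmem : r ∈ ρ.cycleType := by simp [h]
  rw [Perm.cycleType_def, Multiset.mem_map] at hmem
  obtain ⟨c, hc, hcr⟩ := hmem
  have hc : c ∈ ρ.cycleFactorsFinset := hc
  refine ⟨c.support, hcr, Perm.isCycleOn_support_of_mem_cycleFactorsFinset hc, fun x hx => ?_⟩
  have h1 : (ρ * c⁻¹).cycleType = Multiset.replicate k 2 := by
    rw [Perm.cycleType_mul_inv_mem_cycleFactorsFinset_eq_sub hc, h,
      (Perm.mem_cycleFactorsFinset_iff.mp hc).1.cycleType]
    simp only [Function.comp_apply] at hcr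
    simp [hcr]
  have h2 (y : Fin d) (hy : y ∉ c.support) : (ρ * c⁻¹) y = ρ y := by
    rw [Perm.mul_apply, Perm.inv_eq_iff_eq.mpr (Perm.notMem_support.mp hy).symm]
  have h3 : ρ x ∉ c.support := fun h =>
    hx (((Perm.isCycleOn_support_of_mem_cycleFactorsFinset hc).apply_mem_iff).mp h)
  rw [← h2 _ h3, ← h2 _ hx, apply_apply_of_cycleType_replicate h1]

section Involution

variable {ρ : Perm (Fin d)} {S M : Finset (Fin d)}

theorem apply_apply_ne_of_isCycleOn (hS : ρ.IsCycleOn S) (h3 : 3 ≤ #S) {x : Fin d} (hx : x ∈ S) :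
    ρ (ρ x) ≠ x := by
  intro h
  have h1 : (ρ ^ 2) x = x := by rw [pow_two, Perm.mul_apply, h]
  have := Nat.le_of_dvd two_pos ((hS.pow_apply_eq hx).mp h1)
  omega

theorem apply_ne_of_isCycleOn (hS : ρ.IsCycleOn S) (h3 : 3 ≤ #S) {x : Fin d} (hx : x ∈ S) :
    ρ x ≠ x := fun h => apply_apply_ne_of_isCycleOn hS h3 hx (by rw [h, h])

/-- The function that interchanges `x` and `ρ x` for `x` in `M` or outside `S`. -/
def matchFun (ρ : Perm (Fin d)) (S M : Finset (Fin d)) (x : Fin d) : Fin d :=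
  if x ∉ S ∨ x ∈ M then ρ x else if ρ⁻¹ x ∈ M then ρ⁻¹ x else x

theorem matchFun_involutive (hS : ρ.IsCycleOn S) (h2 : ∀ x ∉ S, ρ (ρ x) = x)
    (hM : ∀ x ∈ M, ρ x ∉ M) (hMS : M ⊆ S) : Function.Involutive (matchFun ρ S M) := by
  intro x
  by_cases hx : x ∈ S
  · by_cases hxM : x ∈ M
    · have h1 : ρ x ∈ S := hS.apply_mem_iff.mpr hx
      simp [matchFun, hx, hxM, h1, hM x hxM]
    · by_cases hx' : ρ⁻¹ x ∈ M
      · have h3 := hMS hx'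
        simp only [matchFun, hx, hxM, hx', not_true, or_self, if_false, if_true, or_true]
        simp
      · simp only [matchFun, hx, hxM, hx', not_true, or_self, if_false]
  · have h1 : ρ x ∉ S := fun h => hx (hS.apply_mem_iff.mp h)
    simp [matchFun, hx, h1, h2]

/-- `matchFun` as a permutation. -/
def matchPerm (hS : ρ.IsCycleOn S) (h2 : ∀ x ∉ S, ρ (ρ x) = x)
    (hM : ∀ x ∈ M, ρ x ∉ M) (hMS : M ⊆ S) : Perm (Fin d) :=
  (matchFun_involutive hS h2 hM hMS).toPerm

theorem card_matched (hS : ρ.IsCycleOn S) (h3 : 3 ≤ #S) (hM : ∀ x ∈ M, ρ x ∉ M)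
    (hMS : M ⊆ S) : #((ρ.support \ S) ∪ (M ∪ M.image ρ)) + #S = #ρ.support + 2 * #M := by
  have h1 : S ⊆ ρ.support := fun x hx => Perm.mem_support.mpr (apply_ne_of_isCycleOn hS h3 hx)
  have h4 : M.image ρ ⊆ S := fun y hy => by
    obtain ⟨x, hx, rfl⟩ := mem_image.mp hy
    exact hS.apply_mem_iff.mpr (hMS hx)
  have h5 : _root_.Disjoint M (M.image ρ) := by
    rw [disjoint_left]
    intro y hy hy'
    obtain ⟨x, hx, rfl⟩ := mem_image.mp hy'
    exact hM x hx hy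
  rw [card_union_of_disjoint, card_union_of_disjoint h5, card_image_of_injective _ ρ.injective,
    card_sdiff_of_subset h1]
  · have := card_le_card h1
    omega
  · exact disjoint_of_subset_right (union_subset hMS h4) sdiff_disjoint

theorem support_matchPerm (hS : ρ.IsCycleOn S) (h3 : 3 ≤ #S) (h2 : ∀ x ∉ S, ρ (ρ x) = x)
    (hM : ∀ x ∈ M, ρ x ∉ M) (hMS : M ⊆ S) :
    (matchPerm hS h2 hM hMS).support = (ρ.support \ S) ∪ (M ∪ M.image ρ) := by
  ext x
  have e : x ∈ M.image ρ ↔ ρ⁻¹ x ∈ M := by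
    rw [mem_image]
    constructor
    · rintro ⟨y, hy, rfl⟩
      simpa using hy
    · exact fun h => ⟨_, h, by simp⟩
  rw [Perm.mem_support, mem_union, mem_union, mem_sdiff, e, Perm.mem_support]
  change matchFun ρ S M x ≠ x ↔ _
  by_cases hx : x ∈ S
  · by_cases hxM : x ∈ M
    · simp [matchFun, hx, hxM, apply_ne_of_isCycleOn hS h3 hx]
    · by_cases hx' : ρ⁻¹ x ∈ M
      · have h4 : ρ⁻¹ x ≠ x := fun h => hxM (h ▸ hx')
        simp only [matchFun, hx, hxM, hx', not_true, or_self, if_false, if_true, or_true]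
        simpa using h4
      · simp only [matchFun, hx, hxM, hx', not_true, or_self, if_false, ne_eq, and_false]
  · have hxM : x ∉ M := fun h => hx (hMS h)
    have hx' : ρ⁻¹ x ∉ M := fun h => hx (by simpa using hS.apply_mem_iff.mpr (hMS h))
    simp only [matchFun, hx, hxM, hx']
    simp

theorem cycleType_matchPerm (hS : ρ.IsCycleOn S) (h3 : 3 ≤ #S) (h2 : ∀ x ∉ S, ρ (ρ x) = x)
    (hM : ∀ x ∈ M, ρ x ∉ M) (hMS : M ⊆ S) {k : ℕ} (hk : #ρ.support = #S + 2 * k) :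
    (matchPerm hS h2 hM hMS).cycleType = Multiset.replicate (#M + k) 2 := by
  obtain ⟨s, hs⟩ := cycleType_of_involutive (σ := matchPerm hS h2 hM hMS)
    (matchFun_involutive hS h2 hM hMS)
  have h4 := Perm.sum_cycleType (matchPerm hS h2 hM hMS)
  have h5 := card_matched hS h3 hM hMS
  rw [hs, support_matchPerm hS h3, Multiset.sum_replicate, smul_eq_mul] at h4
  rw [hs]
  congr 1
  omega

theorem matchPerm_mul_apply (hS : ρ.IsCycleOn S) (h2 : ∀ x ∉ S, ρ (ρ x) = x)
    (hM : ∀ x ∈ M, ρ x ∉ M) (hMS : M ⊆ S) (x : Fin d) :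
    (matchPerm hS h2 hM hMS * ρ) x =
      if x ∉ S ∨ x ∈ M then x else if ρ x ∈ M then ρ (ρ x) else ρ x := by
  change matchFun ρ S M (ρ x) = _
  by_cases hx : x ∈ S
  · have h1 : ρ x ∈ S := hS.apply_mem_iff.mpr hx
    by_cases hxM : x ∈ M
    · simp [matchFun, hxM, h1, hM x hxM]
    · by_cases hx' : ρ x ∈ M <;> simp [matchFun, hx, hxM, hx', h1]
  · have h1 : ρ x ∉ S := fun h => hx (hS.apply_mem_iff.mp h)
    simp [matchFun, hx, h1, h2]

theorem support_matchPerm_mul (hS : ρ.IsCycleOn S) (h3 : 3 ≤ #S) (h2 : ∀ x ∉ S, ρ (ρ x) = x)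
    (hM : ∀ x ∈ M, ρ x ∉ M) (hMS : M ⊆ S) :
    (matchPerm hS h2 hM hMS * ρ).support = S \ M := by
  ext x
  rw [Perm.mem_support, matchPerm_mul_apply, mem_sdiff]
  by_cases hx : x ∈ S
  · by_cases hxM : x ∈ M
    · simp [hxM]
    · by_cases hx' : ρ x ∈ M
      · simp [hx, hxM, hx', apply_apply_ne_of_isCycleOn hS h3 hx]
      · simp [hx, hxM, hx', apply_ne_of_isCycleOn hS h3 hx]
  · simp [hx]

/-- Since `M` has no two consecutive points, the product runs through `S \ M` in the cyclic order of
`ρ`, skipping the points of `M`. -/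
theorem isCycle_matchPerm_mul (hS : ρ.IsCycleOn S) (h3 : 3 ≤ #S) (h2 : ∀ x ∉ S, ρ (ρ x) = x)
    (hM : ∀ x ∈ M, ρ x ∉ M) (hMS : M ⊆ S) (hlt : #M < #S) :
    (matchPerm hS h2 hM hMS * ρ).IsCycle := by
  set τ := matchPerm hS h2 hM hMS * ρ with hτ
  have hsupp (x : Fin d) : τ x ≠ x ↔ x ∈ S ∧ x ∉ M := by
    rw [← Perm.mem_support, support_matchPerm_mul hS h3 h2 hM hMS, mem_sdiff]
  -- Strong induction, because one step of `τ` covers one or two steps of `ρ`.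
  have key : ∀ n : ℕ, ∀ x, x ∈ S → x ∉ M → (ρ ^ n) x ∉ M → τ.SameCycle x ((ρ ^ n) x) := by
    intro n
    induction n using Nat.strong_induction_on with
    | _ n ih =>
      intro x hxS hxM hy
      rcases n with _ | n
      · exact Perm.SameCycle.refl _ _
      · have hτx := matchPerm_mul_apply hS h2 hM hMS x
        rw [← hτ] at hτx
        have h1 : ρ x ∈ S := hS.apply_mem_iff.mpr hxS
        rw [pow_succ, Perm.mul_apply] at hy ⊢
        rw [← Perm.sameCycle_apply_left]
        by_cases hx' : ρ x ∈ M
        · rcases n with _ | n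
          · exact absurd hx' hy
          · rw [hτx]
            simp only [hxS, hxM, hx', not_true, or_self, if_false, if_true]
            rw [pow_succ, Perm.mul_apply] at hy ⊢
            exact ih n (by omega) _ (hS.apply_mem_iff.mpr h1) (hM _ hx') hy
        · rw [hτx]
          simp only [hxS, hxM, hx', not_true, or_self, if_false]
          exact ih n (by omega) _ h1 hx' hy
  obtain ⟨x, hxS, hxM⟩ := exists_mem_notMem_of_card_lt_card hlt
  refine ⟨x, (hsupp x).mpr ⟨hxS, hxM⟩, fun y hy => ?_⟩
  obtain ⟨hyS, hyM⟩ := (hsupp y).mp hy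
  obtain ⟨n, -, rfl⟩ := hS.exists_pow_eq hxS hyS
  exact key n x hxS hxM hyM

/-- The set where `σ` and `ρ` agree on `S` determines `σ`: the cycle `σ * ρ` is confined to `S` and
fixes exactly `M` there, which gives the size of `M`. Then `σ` is known off `S`, on `M` and on
`ρ(M)`, and its support has no room for more. -/
theorem eq_matchFun {σ : Perm (Fin d)} (hS : ρ.IsCycleOn S) (h3 : 3 ≤ #S)
    {k s p : ℕ} (hk : #ρ.support = #S + 2 * k) (hsp : s + p = #S + k)
    (hn : norm ρ = norm σ + norm (σ⁻¹ * ρ)) (hσ : σ.cycleType = Multiset.replicate s 2)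
    (hτ : (σ⁻¹ * ρ).cycleType = {p}) :
    (#{x ∈ S | σ x = ρ x} + k = s ∧ ∀ x ∈ ({x ∈ S | σ x = ρ x} : Finset (Fin d)),
      ρ x ∉ ({x ∈ S | σ x = ρ x} : Finset (Fin d))) ∧
      ∀ x, σ x = matchFun ρ S {x ∈ S | σ x = ρ x} x := by
  have hσ2 := apply_apply_of_cycleType_replicate hσ
  have hinv : σ⁻¹ = σ := by
    ext x
    rw [Perm.inv_eq_iff_eq.mpr (hσ2 x).symm]
  obtain ⟨hc, hp⟩ := cycleType_eq_singleton_iff.mp hτ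
  rw [hinv] at hc hp hn
  have hρ : ρ = σ * (σ * ρ) := by
    ext x
    simp [hσ2]
  set M : Finset (Fin d) := {x ∈ S | σ x = ρ x} with hMdef
  have hMmem (x : Fin d) : x ∈ M ↔ x ∈ S ∧ σ x = ρ x := by simp [hMdef]
  have hfix (x : Fin d) : (σ * ρ) x = x ↔ σ x = ρ x := by
    rw [Perm.mul_apply]
    constructor
    · intro h
      rw [← hσ2 (ρ x), h]
    · intro h
      rw [← h, hσ2]
  have hM : ∀ x ∈ M, ρ x ∉ M := by
    intro x hx hx'
    refine apply_apply_ne_of_isCycleOn hS h3 ((hMmem x).mp hx).1 ?_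
    rw [← ((hMmem _).mp hx').2, ← ((hMmem _).mp hx).2, hσ2]
  have hMS : M ⊆ S := filter_subset _ _
  have hsub : (σ * ρ).support ⊆ S := by
    have hgeo : norm (σ * (σ * ρ)) = norm σ + norm (σ * ρ) := by rwa [← hρ]
    -- If `σ * ρ` fixed all of `S`, then `σ` would agree with `ρ` at both `x` and `ρ x`, forcing `ρ
    -- (ρ x) = x`.
    obtain ⟨x, hxS, hx⟩ : ∃ x ∈ S, (σ * ρ) x ≠ x := by
      by_contra! hcon
      obtain ⟨x, hx⟩ := card_pos.mp (by omega : 0 < #S)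
      have h1 := (hfix x).mp (hcon x hx)
      have h2 := (hfix _).mp (hcon _ (hS.apply_mem_iff.mpr hx))
      exact apply_apply_ne_of_isCycleOn hS h3 hx (by rw [← h2, ← h1, hσ2])
    intro y hy
    by_contra hyS
    refine Perm.mem_support.mp hy (apply_eq_self_of_not_sameCycle hgeo hc hx ?_)
    rw [← hρ]
    rintro ⟨n, rfl⟩
    exact hyS ((hS.1.perm_zpow n).mapsTo hxS)
  have hsupp : (σ * ρ).support = S \ M := by
    ext x
    rw [mem_sdiff, hMmem, ← hfix, Perm.mem_support]
    exact ⟨fun h => ⟨hsub (Perm.mem_support.mpr h), fun h' => h h'.2⟩, fun h h' => h.2 ⟨h.1, h'⟩⟩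
  rw [hsupp, card_sdiff_of_subset hMS] at hp
  have hle := card_le_card hMS
  have hcard : #M + k = s := by omega
  refine ⟨⟨hcard, hM⟩, ?_⟩
  have hoff (x : Fin d) (hx : x ∉ S) : σ x = ρ x :=
    (hfix x).mp (Perm.notMem_support.mp fun h => hx (hsub h))
  have himg (x : Fin d) (hx : ρ⁻¹ x ∈ M) : σ x = ρ⁻¹ x := by
    have h1 := ((hMmem _).mp hx).2
    have h2 : ρ (ρ⁻¹ x) = x := by simp
    rw [h2] at h1
    rw [← h1, hσ2, h1]
  -- All these points are moved by `σ`, and their number `2 * k + 2 * #M = 2 * s` is the size of its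
  -- support.
  have hsσ : (ρ.support \ S) ∪ (M ∪ M.image ρ) = σ.support := by
    refine eq_of_subset_of_card_le ?_ ?_
    · intro x hx
      rw [Perm.mem_support]
      rcases mem_union.mp hx with hx | hx
      · rw [hoff x (mem_sdiff.mp hx).2]
        exact Perm.mem_support.mp (mem_sdiff.mp hx).1
      · rcases mem_union.mp hx with hx | hx
        · rw [((hMmem x).mp hx).2]
          exact apply_ne_of_isCycleOn hS h3 (hMS hx)
        · obtain ⟨y, hy, rfl⟩ := mem_image.mp hx
          have h1 : ρ⁻¹ (ρ y) = y := by simp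
          rw [himg _ (by rwa [h1]), h1]
          exact (apply_ne_of_isCycleOn hS h3 (hMS hy)).symm
    · have h1 := Perm.sum_cycleType σ
      have h2 := card_matched hS h3 hM hMS
      rw [hσ, Multiset.sum_replicate, smul_eq_mul] at h1
      omega
  intro x
  unfold matchFun
  split_ifs with h1 h2
  · rcases h1 with h1 | h1
    · exact hoff x h1
    · exact ((hMmem x).mp h1).2
  · exact himg x h2
  · push Not at h1
    refine Perm.notMem_support.mp ?_
    rw [← hsσ]
    simp only [mem_union, mem_sdiff, mem_image, not_or, not_exists, not_and, not_not]
    refine ⟨fun _ => h1.1, h1.2, fun y hy hyx => h2 ?_⟩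
    rw [← hyx]
    simpa using hy

/-- The bijection sends `σ` to the set where it agrees with `ρ` on `S`; its inverse is `matchPerm`.
-/
theorem coeff_del_mul_gam_of_isCycleOn (hS : ρ.IsCycleOn S) (h3 : 3 ≤ #S)
    (h2 : ∀ x ∉ S, ρ (ρ x) = x) {k s p : ℕ} (hk : #ρ.support = #S + 2 * k)
    (hn : norm ρ + 1 = #S + k) (hsp : s + p = #S + k) (hp : 2 ≤ p) :
    (del d s * gam d p).1.coeff ρ =
      (#{M ∈ S.powerset | #M + k = s ∧ ∀ x ∈ M, ρ x ∉ M} : ℚ) := by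
  rw [del, gam, coeff_classSum_mul]
  norm_cast
  refine card_bij (fun σ _ => {x ∈ S | σ x = ρ x}) ?_ ?_ ?_
  · intro σ hσ
    simp only [mem_filter, mem_univ, true_and] at hσ
    have := (eq_matchFun hS h3 hk hsp hσ.1 hσ.2.1 hσ.2.2).1
    simp only [mem_filter, mem_powerset] at this ⊢
    exact ⟨filter_subset _ _, this⟩
  · intro σ hσ σ' hσ' he
    simp only [mem_filter, mem_univ, true_and] at hσ hσ'
    ext x
    rw [(eq_matchFun hS h3 hk hsp hσ.1 hσ.2.1 hσ.2.2).2 x,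
      (eq_matchFun hS h3 hk hsp hσ'.1 hσ'.2.1 hσ'.2.2).2 x, he]
  · intro M hM
    simp only [mem_filter, mem_powerset] at hM
    obtain ⟨hMS, hMk, hM⟩ := hM
    have hinv : (matchPerm hS h2 hM hMS)⁻¹ = matchPerm hS h2 hM hMS := by
      ext x
      exact congrArg _ (Perm.inv_eq_iff_eq.mpr (matchFun_involutive hS h2 hM hMS x).symm)
    have hct := cycleType_matchPerm hS h3 h2 hM hMS hk
    rw [hMk] at hct
    have hct' : (matchPerm hS h2 hM hMS * ρ).cycleType = {p} := by
      refine cycleType_eq_singleton_iff.mpr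
        ⟨isCycle_matchPerm_mul hS h3 h2 hM hMS (by omega), ?_⟩
      rw [support_matchPerm_mul hS h3, card_sdiff_of_subset hMS]
      omega
    refine ⟨matchPerm hS h2 hM hMS, ?_, ?_⟩
    · simp only [mem_filter, mem_univ, true_and, hinv]
      refine ⟨?_, hct, hct'⟩
      have h4 := norm_of_cycleType_replicate hct
      have h5 := norm_of_cycleType_singleton hct'
      omega
    · ext x
      have h4 := support_matchPerm_mul hS h3 h2 hM hMS
      have h5 : matchPerm hS h2 hM hMS x = ρ x ↔ (matchPerm hS h2 hM hMS * ρ) x = x := by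
        rw [Perm.mul_apply]
        constructor
        · intro h
          rw [← h]
          exact matchFun_involutive hS h2 hM hMS x
        · intro h
          rw [← matchFun_involutive hS h2 hM hMS (ρ x)]
          exact (congrArg _ h).symm
      rw [mem_filter, h5, ← Perm.notMem_support, h4, mem_sdiff]
      exact ⟨fun h => by_contra fun h' => h.2 ⟨h.1, h'⟩, fun h => ⟨hMS h, fun h' => h'.2 h⟩⟩

end Involution

theorem coeff_del_mul_gam {ρ : Perm (Fin d)} {r k s p : ℕ} (hr : 3 ≤ r)
    (h : ρ.cycleType = r ::ₘ Multiset.replicate k 2) (hsp : s + p = r + k) (hp : 2 ≤ p) :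
    (del d s * gam d p).1.coeff ρ = if k ≤ s then cycIndep r (s - k) else 0 := by
  obtain ⟨S, rfl, hS, h2⟩ := exists_isCycleOn h
  have hk : #ρ.support = #S + 2 * k := by
    rw [← Perm.sum_cycleType, h]
    simp [mul_comm]
  rw [coeff_del_mul_gam_of_isCycleOn hS hr h2 hk (norm_of_cycleType_cons h) hsp hp]
  split_ifs with hks
  · rw [← card_indep_of_isCycleOn hS hr]
    congr 3
    ext M
    rw [show #M + k = s ↔ #M = s - k by omega]
  · rw [Nat.cast_eq_zero, card_eq_zero, filter_eq_empty_iff]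
    rintro M - ⟨h1, -⟩
    omega

theorem exists_cycleType_of_coeff_ne_zero {ρ : Perm (Fin d)} {s p : ℕ}
    (h : (del d s * gam d p).1.coeff ρ ≠ 0) :
    norm ρ + 1 = s + p ∧ ∃ r k, 2 ≤ r ∧ r + k = s + p ∧
      ρ.cycleType = r ::ₘ Multiset.replicate k 2 := by
  obtain ⟨σ, τ, rfl, hn, h1, h2⟩ := exists_of_coeff_mul_ne_zero h
  rw [del, coeff_classSum, ite_ne_right_iff] at h1
  rw [gam, coeff_classSum, ite_ne_right_iff] at h2
  have hN : norm (σ * τ) + 1 = s + p := by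
    rw [hn, norm_of_cycleType_replicate h1.1, add_assoc, norm_of_cycleType_singleton h2.1]
  obtain ⟨r, k, hr, hct⟩ := cycleType_of_involutive_mul_isCycle hn
    (apply_apply_of_cycleType_replicate h1.1) (cycleType_eq_singleton_iff.mp h2.1).1
  exact ⟨hN, r, k, hr, by rw [← norm_of_cycleType_cons hct, hN], hct⟩

/-- A `p`-cycle factor would have to fit into a cycle of `ρ`, which has at most two points. -/
theorem coeff_mul_gam_eq_zero {ρ : Perm (Fin d)} (hρ : ∀ x, ρ (ρ x) = x) (f : Gr d) {p : ℕ}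
    (hp : 3 ≤ p) : (f * (gam d p).1).coeff ρ = 0 := by
  by_contra h
  obtain ⟨σ, τ, rfl, hn, -, h2⟩ := exists_of_coeff_mul_ne_zero h
  rw [gam, coeff_classSum, ite_ne_right_iff, cycleType_eq_singleton_iff] at h2
  obtain ⟨⟨hc, hcard⟩, -⟩ := h2
  obtain ⟨x, hx, -⟩ := id hc
  have h1 : τ.support ⊆ {x, (σ * τ) x} := by
    intro y hy
    obtain ⟨n, rfl⟩ := (sameCycle_mono (sameCycle_right hn)
      (hc.sameCycle hx (Perm.mem_support.mp hy))).exists_nat_pow_eq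
    rw [mem_insert, mem_singleton]
    clear hy
    induction n with
    | zero => simp
    | succ n ih =>
      rw [pow_succ', Perm.mul_apply]
      rcases ih with ih | ih
      · right; rw [ih]
      · left; rw [ih, hρ]
  have h3 := (card_le_card h1).trans card_le_two
  omega

/-- The coefficient counts factorizations, and splitting off one transposition of `ρ` gives one. -/
theorem coeff_del_mul_gam_two_ne_zero {ρ : Perm (Fin d)} {n : ℕ}
    (h : ρ.cycleType = Multiset.replicate (n + 1) 2) :
    (del d n * gam d 2).1.coeff ρ ≠ 0 := by
  have hmem : 2 ∈ ρ.cycleType := by simp [h]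
  rw [Perm.cycleType_def, Multiset.mem_map] at hmem
  obtain ⟨c, hc, hcr⟩ := hmem
  have hc : c ∈ ρ.cycleFactorsFinset := hc
  have hc2 : c.cycleType = {2} :=
    cycleType_eq_singleton_iff.mpr ⟨(Perm.mem_cycleFactorsFinset_iff.mp hc).1, hcr⟩
  have h1 : (ρ * c⁻¹).cycleType = Multiset.replicate n 2 := by
    rw [Perm.cycleType_mul_inv_mem_cycleFactorsFinset_eq_sub hc, h, hc2, Multiset.replicate_succ]
    simp
  have h2 : (ρ * c⁻¹)⁻¹ * ρ = c := by group
  rw [del, gam, coeff_classSum_mul, Nat.cast_ne_zero, ← Nat.pos_iff_ne_zero, card_pos]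
  refine ⟨ρ * c⁻¹, ?_⟩
  simp only [mem_filter, mem_univ, true_and, h2]
  refine ⟨?_, h1, hc2⟩
  rw [← norm_mul_of_disjoint (Perm.disjoint_mul_inv_of_mem_cycleFactorsFinset hc),
    inv_mul_cancel_right]

end SymGr

end

/-! ### The relation, and its nontriviality. -/

noncomputable section

open Finset Equiv

namespace SymGr

variable {d : ℕ}

theorem mul_mem_homogeneous {a b : A d} {k l : ℕ} (ha : a ∈ homogeneous d k)
    (hb : b ∈ homogeneous d l) : a * b ∈ homogeneous d (k + l) := by
  intro ρ hρ
  obtain ⟨σ, τ, rfl, hn, h1, h2⟩ := exists_of_coeff_mul_ne_zero hρ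
  rw [hn, ha σ h1, hb τ h2]

theorem one_mem_homogeneous : (1 : A d) ∈ homogeneous d 0 := by
  intro ρ hρ
  change (1 : Gr d).coeff ρ ≠ 0 at hρ
  rw [Gr.coeff_one, ite_ne_right_iff] at hρ
  rw [hρ.1, norm_one]

theorem pow_mem_homogeneous {a : A d} {k : ℕ} (ha : a ∈ homogeneous d k) (n : ℕ) :
    a ^ n ∈ homogeneous d (n * k) := by
  induction n with
  | zero => simpa using one_mem_homogeneous
  | succ n ih =>
    rw [pow_succ, Nat.succ_mul]
    exact mul_mem_homogeneous ih ha

theorem del_mem_homogeneous (s : ℕ) : del d s ∈ homogeneous d s := by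
  intro ρ hρ
  rw [del, coeff_classSum, ite_ne_right_iff] at hρ
  exact norm_of_cycleType_replicate hρ.1

theorem gam_mem_homogeneous (p : ℕ) : gam d (p + 1) ∈ homogeneous d p := by
  intro ρ hρ
  rw [gam, coeff_classSum, ite_ne_right_iff] at hρ
  exact Nat.succ_injective (norm_of_cycleType_singleton hρ.1)

theorem del_zero : del d 0 = 1 := by
  refine Subtype.ext (Gr.ext fun ρ => ?_)
  rw [del, coeff_classSum]
  change _ = (1 : Gr d).coeff ρ
  simp [Gr.coeff_one]

theorem coeff_sum_smul {ι : Type*} (t : Finset ι) (c : ι → ℚ) (f : ι → A d) (ρ : Perm (Fin d)) :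
    (∑ i ∈ t, c i • f i).1.coeff ρ = ∑ i ∈ t, c i * (f i).1.coeff ρ := by
  rw [AddSubmonoidClass.coe_finsetSum, Gr.coeff_sum]
  rfl

theorem sum_smul_del_mul_gam_eq_zero (m : ℕ) :
    ∑ s ∈ Icc 1 m, ((-1 : ℚ) ^ s * (s : ℚ) * (catalan (m - s) : ℚ)) •
      (del (2 * m) s * gam (2 * m) (m + 2 - s)) = 0 := by
  refine Subtype.ext (Gr.ext fun ρ => ?_)
  rw [coeff_sum_smul]
  change _ = (0 : ℚ)
  by_cases hρ : ∀ s ∈ Icc 1 m, (del (2 * m) s * gam (2 * m) (m + 2 - s)).1.coeff ρ = 0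
  · exact sum_eq_zero fun s hs => by rw [hρ s hs, mul_zero]
  push Not at hρ
  obtain ⟨s, hs, hne⟩ := hρ
  rw [mem_Icc] at hs
  obtain ⟨-, r, k, -, hrk, hct⟩ := exists_cycleType_of_coeff_ne_zero hne
  have hcard := Perm.sum_cycleType_le ρ
  simp [hct] at hcard
  -- Here the degree `2 * m` enters: `r + k = m + 2` and `r + 2 * k ≤ 2 * m`.
  have hr : 4 ≤ r := by omega
  have hcoeff (s : ℕ) (hs : s ∈ Icc 1 m) :=
    coeff_del_mul_gam (s := s) (p := m + 2 - s) (by omega : 3 ≤ r) hct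
      (by rw [mem_Icc] at hs; omega) (by rw [mem_Icc] at hs; omega)
  rw [← sum_catalan_mul_cycIndep hr k]
  have e : ∑ s ∈ Icc 1 m, (-1 : ℚ) ^ s * (s : ℚ) * (catalan (m - s) : ℚ) *
      (del (2 * m) s * gam (2 * m) (m + 2 - s)).1.coeff ρ =
      -- The upper end is `s = m`, as `k + (r - 1) = m + 1`. When `k = 0` the interval also contains
      -- `s = 0`, where the factor `s` kills the term.
      ∑ s ∈ Ico k (k + (r - 1)), (-1 : ℚ) ^ s * (s : ℚ) * (catalan (m - s) : ℚ) *
        cycIndep r (s - k) := by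
    have h1 : ∑ s ∈ Icc 1 m, (-1 : ℚ) ^ s * (s : ℚ) * (catalan (m - s) : ℚ) *
        (del (2 * m) s * gam (2 * m) (m + 2 - s)).1.coeff ρ =
        ∑ s ∈ Icc 1 m, (-1 : ℚ) ^ s * (s : ℚ) * (catalan (m - s) : ℚ) *
          if k ≤ s then cycIndep r (s - k) else 0 :=
      sum_congr rfl fun s hs => by rw [hcoeff s hs]
    rw [h1]
    simp only [mul_ite, mul_zero]
    rw [← sum_filter]
    refine sum_subset (fun s hs => ?_) fun s hs hs' => ?_
    · simp only [mem_filter, mem_Icc, mem_Ico] at hs ⊢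
      omega
    · simp only [mem_filter, mem_Icc, mem_Ico] at hs hs'
      obtain rfl : s = 0 := by omega
      simp
  rw [e, sum_Ico_eq_sum_range, Nat.add_sub_cancel_left]
  refine sum_congr rfl fun j hj => ?_
  rw [mem_range] at hj
  rw [Nat.add_sub_cancel_left, show m - (k + j) = r - 2 - j by omega]

/-- The coefficients of `γ_{j+2} δ_{s-1-j}` in a multiple of `δ_s`. -/
def recCoeff : ℕ → ℚ
  | 0 => 1
  | n + 1 => -∑ j : Fin (n + 1), recCoeff j * cycIndep (n + 3) (n + 1 - j)
decreasing_by exact j.2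

/-- The system is triangular: the last unknown, `j = r - 2`, has coefficient `cycIndep r 0 = 1`, and
`recCoeff` solves for it. -/
theorem sum_recCoeff {r : ℕ} (hr : 3 ≤ r) :
    ∑ j ∈ range (r - 1), recCoeff j * cycIndep r (r - 2 - j) = 0 := by
  obtain ⟨n, rfl⟩ : ∃ n, r = n + 3 := ⟨r - 3, by omega⟩
  rw [show n + 3 - 1 = n + 1 + 1 by omega, sum_range_succ, show n + 3 - 2 = n + 1 by omega,
    Nat.sub_self, cycIndep_zero, mul_one, recCoeff,
    Fin.sum_univ_eq_sum_range (fun j => recCoeff j * cycIndep (n + 3) (n + 1 - j)) (n + 1)]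
  ring

theorem coeff_eq_of_cycleType_eq (a : A d) {ρ ρ' : Perm (Fin d)}
    (h : ρ.cycleType = ρ'.cycleType) : a.1.coeff ρ = a.1.coeff ρ' := by
  obtain ⟨g, rfl⟩ := isConj_iff.mp (Perm.isConj_iff_cycleType_eq.mpr h)
  exact (mem_A.mp a.2 g ρ).symm

/-- By `sum_recCoeff` the coefficients of the sum at types with a cycle of length `r ≥ 3` vanish. At
products of `n + 1` transpositions only `j = 0` contributes, with a nonzero value by which one
divides. -/
theorem exists_smul_del_eq_sum (n : ℕ) :
    ∃ e : ℚ, del d (n + 1) =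
      e • ∑ j ∈ range (n + 1), recCoeff j • (del d (n - j) * gam d (j + 2)) := by
  set f : A d := ∑ j ∈ range (n + 1), recCoeff j • (del d (n - j) * gam d (j + 2)) with hf
  have hcoeff (ρ : Perm (Fin d)) (hρ : ρ.cycleType ≠ Multiset.replicate (n + 1) 2) :
      f.1.coeff ρ = 0 := by
    rw [hf, coeff_sum_smul]
    by_cases h0 : ∀ j ∈ range (n + 1), (del d (n - j) * gam d (j + 2)).1.coeff ρ = 0
    · exact sum_eq_zero fun j hj => by rw [h0 j hj, mul_zero]
    push Not at h0
    obtain ⟨j, hj, hne⟩ := h0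
    rw [mem_range] at hj
    obtain ⟨-, r, k, hr, hrk, hct⟩ := exists_cycleType_of_coeff_ne_zero hne
    have hr3 : 3 ≤ r := by
      by_contra hlt
      obtain rfl : r = 2 := by omega
      obtain rfl : k = n := by omega
      exact hρ hct
    have h1 : ∑ j ∈ range (n + 1), recCoeff j * (del d (n - j) * gam d (j + 2)).1.coeff ρ =
        ∑ j ∈ range (n + 1), if k ≤ n - j then recCoeff j * cycIndep r (n - j - k) else 0 := by
      refine sum_congr rfl fun j hj => ?_
      rw [mem_range] at hj
      rw [coeff_del_mul_gam hr3 hct (by omega) (by omega), mul_ite, mul_zero]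
    rw [h1, ← sum_filter, ← sum_recCoeff hr3]
    have h2 : (range (n + 1)).filter (fun j => k ≤ n - j) = range (r - 1) := by
      ext j
      simp only [mem_filter, mem_range]
      omega
    rw [h2]
    refine sum_congr rfl fun j hj => ?_
    rw [mem_range] at hj
    rw [show n - j - k = r - 2 - j by omega]
  have hcoeff' (ρ : Perm (Fin d)) (hρ : ρ.cycleType = Multiset.replicate (n + 1) 2) :
      f.1.coeff ρ ≠ 0 := by
    rw [hf, coeff_sum_smul, sum_eq_single 0]
    · simpa [recCoeff] using coeff_del_mul_gam_two_ne_zero hρ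
    · intro j _ hj
      have h1 : (del d (n - j) * gam d (j + 2)).1.coeff ρ = 0 :=
        coeff_mul_gam_eq_zero (apply_apply_of_cycleType_replicate hρ) _ (by omega)
      rw [h1, mul_zero]
    · simp
  by_cases hex : ∃ ρ : Perm (Fin d), ρ.cycleType = Multiset.replicate (n + 1) 2
  · obtain ⟨ρ₀, h0⟩ := hex
    refine ⟨(f.1.coeff ρ₀)⁻¹, Subtype.ext (Gr.ext fun ρ => ?_)⟩
    change _ = (f.1.coeff ρ₀)⁻¹ * f.1.coeff ρ
    rw [del, coeff_classSum]
    split_ifs with h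
    · rw [coeff_eq_of_cycleType_eq f (h.trans h0.symm), inv_mul_cancel₀ (hcoeff' ρ₀ h0)]
    · rw [hcoeff ρ h, mul_zero]
  -- If `d` is too small for `n + 1` disjoint transpositions, then `δ_{n+1} = 0`.
  · refine ⟨0, Subtype.ext (Gr.ext fun ρ => ?_)⟩
    rw [del, coeff_classSum, if_neg fun h => hex ⟨ρ, h⟩, zero_smul]
    rfl

open MvPolynomial in
theorem exists_aeval_gam_eq_del (s : ℕ) : ∃ P : MvPolynomial ℕ ℚ, P.vars ⊆ Icc 2 (s + 1) ∧
    P.IsWeightedHomogeneous (fun i => i - 1) s ∧ aeval (gam d) P = del d s := by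
  induction s using Nat.strong_induction_on with
  | _ s ih =>
    rcases s with _ | n
    · exact ⟨1, by simp, isWeightedHomogeneous_one ℚ _, by rw [map_one, del_zero]⟩
    · choose! P h1 h2 h3 using ih
      obtain ⟨e, he⟩ := exists_smul_del_eq_sum (d := d) n
      refine ⟨C e * ∑ j ∈ range (n + 1), C (recCoeff j) * (P (n - j) * X (j + 2)), ?_, ?_, ?_⟩
      · refine (vars_mul _ _).trans ?_
        rw [vars_C, empty_union]
        refine (vars_sum_subset _ _).trans ?_
        refine biUnion_subset.mpr fun j hj => ?_
        rw [mem_range] at hj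
        refine (vars_mul _ _).trans ?_
        rw [vars_C, empty_union]
        refine (vars_mul _ _).trans (union_subset ?_ ?_)
        · exact (h1 (n - j) (by omega)).trans (Icc_subset_Icc_right (by omega))
        · rw [vars_X, singleton_subset_iff, mem_Icc]
          omega
      · rw [← zero_add (n + 1)]
        refine (isWeightedHomogeneous_C _ e).mul (IsWeightedHomogeneous.sum _ _ _ fun j hj => ?_)
        rw [mem_range] at hj
        rw [← zero_add (n + 1)]
        refine (isWeightedHomogeneous_C _ _).mul ?_
        have h4 := (h2 (n - j) (by omega)).mul (isWeightedHomogeneous_X ℚ (fun i => i - 1) (j + 2))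
        have h5 : n - j + (j + 2 - 1) = n + 1 := by omega
        rwa [h5] at h4
      · rw [map_mul, map_sum, he, Algebra.smul_def]
        congr 1
        · exact aeval_C _ _
        · refine sum_congr rfl fun j hj => ?_
          rw [map_mul, map_mul, h3 (n - j) (by omega), aeval_X, aeval_C, ← Algebra.smul_def]

open MvPolynomial in
-- Evaluate at a product `ρ` of `m` disjoint transpositions. A monomial with some `γ_i`, `i ≥ 3`,
-- does not reach `ρ`, and a power `γ_2^e` with `e ≠ m` has the wrong norm; yet `δ_m` has
-- coefficient `1` at `ρ`.
theorem coeff_single_two_ne_zero {m : ℕ} (hm : 2 * m ≤ d) {P : MvPolynomial ℕ ℚ} {n : ℕ}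
    (hv : P.vars ⊆ Icc 2 n) (hP : aeval (gam d) P = del d m) :
    P.coeff (Finsupp.single 2 m) ≠ 0 := by
  intro hc
  obtain ⟨ρ, hρ⟩ : ∃ ρ : Perm (Fin d), ρ.cycleType = Multiset.replicate m 2 := by
    refine (Equiv.Perm.exists_with_cycleType_iff (Fin d)).mpr ⟨?_, ?_⟩
    · simpa [mul_comm] using hm
    · intro a ha
      rw [Multiset.eq_of_mem_replicate ha]
  have h1 : (del d m).1.coeff ρ = 1 := by rw [del, coeff_classSum, if_pos hρ]
  have h2 : aeval (gam d) P = ∑ v ∈ P.support, P.coeff v • v.prod fun i e => gam d i ^ e := by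
    rw [aeval_def, eval₂_eq]
    exact sum_congr rfl fun v _ => (Algebra.smul_def _ _).symm
  rw [← hP, h2, coeff_sum_smul] at h1
  refine one_ne_zero (h1.symm.trans (sum_eq_zero fun v hvP => ?_))
  have hvs : ∀ i ∈ v.support, 2 ≤ i := fun i hi =>
    (mem_Icc.mp (hv ((mem_vars_iff_mem_support _).mpr ⟨v, hvP, hi⟩))).1
  by_cases h3 : ∃ i ∈ v.support, 3 ≤ i
  · obtain ⟨i, hi, hi3⟩ := h3
    have h4 : (v.prod fun i e => gam d i ^ e) =
        (gam d i ^ (v i - 1) * (v.erase i).prod fun i e => gam d i ^ e) * gam d i := by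
      rw [← Finsupp.mul_prod_erase v i _ hi, mul_right_comm, ← pow_succ,
        Nat.sub_add_cancel (Nat.one_le_iff_ne_zero.mpr (Finsupp.mem_support_iff.mp hi))]
    have h5 : (v.prod fun i e => gam d i ^ e).1.coeff ρ = 0 := by
      rw [h4]
      exact coeff_mul_gam_eq_zero (apply_apply_of_cycleType_replicate hρ) _ hi3
    rw [h5, mul_zero]
  · push Not at h3
    have h4 : v = Finsupp.single 2 (v 2) := by
      ext i
      rw [Finsupp.single_apply]
      split_ifs with h
      · rw [h]
      · by_contra hi
        have hi' := Finsupp.mem_support_iff.mpr hi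
        have h6 := hvs i hi'
        have h7 := h3 i hi'
        omega
    by_cases h5 : v 2 = m
    · rw [h4, h5, hc, zero_mul]
    · have h6 : (v.prod fun i e => gam d i ^ e) = gam d 2 ^ v 2 := by
        rw [h4, Finsupp.single_eq_same]
        exact Finsupp.prod_single_index (pow_zero _)
      have h7 : (gam d 2 ^ v 2).1.coeff ρ = 0 := by
        by_contra h8
        have h9 := pow_mem_homogeneous (gam_mem_homogeneous 1) (v 2) ρ h8
        rw [norm_of_cycleType_replicate hρ, mul_one] at h9
        exact h5 h9.symm
      rw [h6, h7, mul_zero]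

end SymGr

end

theorem mainTheorem4 (m : ℕ) (hm : 1 ≤ m) :
    -- every term of the relation lies in the part of norm `m + 1` of `𝒜(2m)`
    (∀ s ∈ Finset.Icc 1 m,
      SymGr.del (2 * m) s * SymGr.gam (2 * m) (m + 2 - s) ∈ SymGr.homogeneous (2 * m) (m + 1)) ∧
    -- the relation
    (∑ s ∈ Finset.Icc 1 m, ((-1 : ℚ) ^ s * (s : ℚ) * (catalan (m - s) : ℚ)) •
      (SymGr.del (2 * m) s * SymGr.gam (2 * m) (m + 2 - s)) = 0) ∧
    -- every `δ_s` is a polynomial in `γ_2, …, γ_{m+1}`, homogeneous of norm `s`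
    (∀ s ∈ Finset.Icc 1 m, ∃ P : MvPolynomial ℕ ℚ, P.vars ⊆ Finset.Icc 2 (m + 1) ∧
      P.IsWeightedHomogeneous (fun i => i - 1) s ∧
      MvPolynomial.aeval (SymGr.gam (2 * m)) P = SymGr.del (2 * m) s) ∧
    -- rewriting the `δ_s` in this way, the relation has a nonzero coefficient at `γ_2 ^ (m + 1)`
    (∀ P : ℕ → MvPolynomial ℕ ℚ,
      (∀ s ∈ Finset.Icc 1 m, (P s).vars ⊆ Finset.Icc 2 (m + 1) ∧
        MvPolynomial.aeval (SymGr.gam (2 * m)) (P s) = SymGr.del (2 * m) s) →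
      MvPolynomial.coeff (Finsupp.single 2 (m + 1))
        (∑ s ∈ Finset.Icc 1 m,
          MvPolynomial.C ((-1 : ℚ) ^ s * (s : ℚ) * (catalan (m - s) : ℚ)) *
            P s * MvPolynomial.X (m + 2 - s)) ≠ 0) := by
  refine ⟨fun s hs => ?_, SymGr.sum_smul_del_mul_gam_eq_zero m, fun s hs => ?_, fun P hP => ?_⟩
  · rw [Finset.mem_Icc] at hs
    have h := SymGr.mul_mem_homogeneous (d := 2 * m) (SymGr.del_mem_homogeneous s)
      (SymGr.gam_mem_homogeneous (m + 1 - s))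
    rwa [show m + 1 - s + 1 = m + 2 - s by omega, show s + (m + 1 - s) = m + 1 by omega] at h
  · rw [Finset.mem_Icc] at hs
    obtain ⟨P, h1, h2, h3⟩ := SymGr.exists_aeval_gam_eq_del (d := 2 * m) s
    exact ⟨P, h1.trans (Finset.Icc_subset_Icc_right (by omega)), h2, h3⟩
  -- For `s < m` the factor `X_{m+2-s}` is a variable other than `X_2`.
  · rw [MvPolynomial.coeff_sum, Finset.sum_eq_single m]
    · have h1 := hP m (Finset.mem_Icc.mpr ⟨hm, le_rfl⟩)
      have h2 := SymGr.coeff_single_two_ne_zero le_rfl h1.1 h1.2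
      have h3 : (m : ℚ) ≠ 0 := by exact_mod_cast (by omega : m ≠ 0)
      rw [show m + 2 - m = 2 by omega, Finsupp.single_add, MvPolynomial.coeff_mul_X,
        MvPolynomial.coeff_C_mul, Nat.sub_self, catalan_zero]
      simp [h2, h3]
    · intro s hs hsm
      rw [Finset.mem_Icc] at hs
      rw [MvPolynomial.coeff_mul_X', if_neg]
      intro h
      have h1 := Finsupp.support_single_subset h
      rw [Finset.mem_singleton] at h1
      omega
    · intro h
      exact absurd (Finset.mem_Icc.mpr ⟨hm, le_rfl⟩) h
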